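/- Let $m\ge 3$, let $W=I_2(m)$ be the dihedral group acting on $\mathbb C[z,\bar z]$, with reflections $s_j$ ($0\le j<m$), $s_j(z)=-\zeta^j\bar z$, $s_j(\bar z)=-\zeta^{-j}z$, $\zeta=e^{2\pi i/m}$, and let $\alpha_j=z+\zeta^j\bar z$ be the corresponding roots. For a constant $c\in\mathbb C$ consider the Dunkl operators $$\nabla_z=\frac{\partial}{\partial z}-c\sum_{j=0}^{m-1}\frac{1-s_j}{\alpha_j},\qquad \nabla_{\bar z}=\frac{\partial}{\partial\bar z}-c\sum_{j=0}^{m-1}\zeta^j\,\frac{1-s_j}{\alpha_j}.$$ Call $c$ regular if no polynomial of positive degree is annihilated by all Dunkl operators (i.e. by $\nabla_z$ and $\nabla_{\bar z}$). Let $J_{n,c}\subset\mathbb C[z,\bar z]$ be the ideal generated by the homogeneous quasiharmonic polynomials of degree $n$, that is, by the homogeneous $f$ of degree $n$ with $\nabla_z\nabla_{\bar z}f=0$. A standard Frobenius algebra of degree $N$ is a finite-dimensional graded commutative $\mathbb C$-algebra $A=\bigoplus_{k=0}^N A_k$ with $\dim A_0=1$, generated by $A_1$, such that $\dim A_N=1$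 and $(a,b)\mapsto \mathrm{pr}_N(ab)$ is a nondegenerate bilinear form. If $A=\mathbb C[z,\bar z]/J$ with $J$ homogeneous, its characteristic polynomial is the homogeneous polynomial $p$ of degree $N$, unique up to a nonzero scalar multiple, such that the degree-$N$ component of $J$ is the kernel of the functional $\langle p,\cdot\rangle$ on homogeneous polynomials of degree $N$; here $\langle\cdot,\cdot\rangle$ is the bilinear pairing for which distinct monomials are orthogonal and $\langle z^a\bar z^b,z^a\bar z^b\rangle=a!\,b!$. **Theorem.** Let $n=mq+r$ with integers $q\ge 0$, $0\le r\le m-1$, and let $c\in\mathbb C$ be a constant, $c\notin\{1,2,\dots,q\}$. If $c$ is regular, then $\mathbb C[z,\bar z]/J_{n+1,c}$ is a standard Frobenius algebra of degree $2n$. Moreover, whenever (for regular $c$ or not) $\mathbb C[z,\bar z]/J_{n+1,c}$ is a standard Frobenius algebra of degree $2n$, its characteristic polynomial is, up to a nonzero scalar multiple, $$p_{2n,c}=z^{(n)}\bar z^{(n)}+\sum_{k=1}^q(-1)^{mk}\,\frac{c(c+1)\cdots(c+k-1)}{(1-c)(2-c)\cdots(k-c)}\,z^{(n-mk;\,n+mk)},$$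 where $x^{(a)}=x^a/a!$ and $z^{(a;b)}=z^{(a)}\bar z^{(b)}+z^{(b)}\bar z^{(a)}$. -/

import Mathlib

open MvPolynomial

noncomputable section

namespace DihedralCherednik

/-- The polynomial algebra `ℂ[z, z̄]`, i.e. the symmetric algebra `S(V)` of the complexified
reflection representation `V` of `I₂(m)`; `z = X 0` and `z̄ = X 1` form a basis of `V`. -/
abbrev Poly : Type := MvPolynomial (Fin 2) ℂ

/-- The primitive `m`-th root of unity `ζ = exp(2πi/m)`. -/
def zeta (m : ℕ) : ℂ := Complex.exp (2 * Real.pi * Complex.I / m)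

/-- The action on `ℂ[z, z̄]` of the reflection `s_j ∈ I₂(m)`:
`z ↦ -ζ^j z̄`, `z̄ ↦ -ζ^{-j} z`. The reflections of `I₂(m)` are `s_0, …, s_{m-1}`. -/
def reflection (m j : ℕ) : Poly →ₐ[ℂ] Poly :=
  aeval ![-(C (zeta m ^ j) * X 1), -(C ((zeta m ^ j)⁻¹) * X 0)]

/-- Coordinates, in the basis `z, z̄` of `V`, of the root `α_j = z + ζ^j z̄` of `s_j`
(defined up to a nonzero scalar, which does not affect the Dunkl operators). -/
def rootVec (m j : ℕ) : Fin 2 → ℂ := ![1, zeta m ^ j]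

/-- The root `α_j` as an element of `V ⊂ S(V)`. -/
def root (m j : ℕ) : Poly := ∑ i, C (rootVec m j i) * X i

theorem zeta_pow_ne_zero (m j : ℕ) : zeta m ^ j ≠ 0 :=
  pow_ne_zero _ (Complex.exp_ne_zero _)

theorem root_eq (m j : ℕ) : root m j = X 0 + C (zeta m ^ j) * X 1 := by
  simp [root, rootVec]

theorem root_ne_zero (m j : ℕ) : root m j ≠ 0 := by
  intro h
  have h1 := congrArg (MvPolynomial.eval ![(1 : ℂ), 0]) h
  simp [root_eq] at h1

theorem root_dvd (m j : ℕ) (q : Poly) : root m j ∣ q - reflection m j q := by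
  induction q using MvPolynomial.induction_on with
  | C a => simp [reflection]
  | add p q hp hq =>
    have h : p + q - reflection m j (p + q)
        = (p - reflection m j p) + (q - reflection m j q) := by
      rw [map_add]; ring
    rw [h]
    exact dvd_add hp hq
  | mul_X p i hp =>
    have hX : root m j ∣ X i - reflection m j (X i) := by
      fin_cases i
      · refine ⟨1, ?_⟩
        simp [reflection, root_eq]
      · refine ⟨C ((zeta m ^ j)⁻¹), ?_⟩
        have h2 : (C ((zeta m ^ j)⁻¹) : Poly) * C (zeta m ^ j) = 1 := by
          rw [← C_mul, inv_mul_cancel₀ (zeta_pow_ne_zero m j), C_1]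
        simp only [reflection, root_eq, aeval_X, Fin.mk_one, Matrix.cons_val_one,
          Matrix.cons_val_fin_one]
        linear_combination (-(X 1 : Poly)) * h2
    have h : p * X i - reflection m j (p * X i)
        = (p - reflection m j p) * X i
          + reflection m j p * (X i - reflection m j (X i)) := by
      rw [map_mul]; ring
    rw [h]
    exact dvd_add (Dvd.dvd.mul_right hp _) (Dvd.dvd.mul_left hX _)

/-- The difference quotient `q ↦ (q - s_j(q)) / α_j` on `ℂ[z, z̄]`. -/
def diffQuot (m j : ℕ) : Poly →ₗ[ℂ] Poly where
  toFun q := (root_dvd m j q).choose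
  map_add' p q := by
    apply mul_left_cancel₀ (root_ne_zero m j)
    rw [mul_add, ← (root_dvd m j p).choose_spec, ← (root_dvd m j q).choose_spec,
      ← (root_dvd m j (p + q)).choose_spec, map_add]
    ring
  map_smul' a q := by
    apply mul_left_cancel₀ (root_ne_zero m j)
    rw [RingHom.id_apply, mul_smul_comm, ← (root_dvd m j q).choose_spec,
      ← (root_dvd m j (a • q)).choose_spec, map_smul, smul_sub]

theorem root_mul_diffQuot (m j : ℕ) (q : Poly) :
    root m j * diffQuot m j q = q - reflection m j q :=
  (root_dvd m j q).choose_spec.symm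

/-- The Dunkl operator `∇_y` of `I₂(m)` with constant parameter `c`, for the vector
`y = (y 0, y 1) ∈ V*` written in the basis dual to `z, z̄`:
`∇_y q = ∂q/∂y - ∑_j c ⟨y, α_j⟩ (q - s_j q) / α_j`. -/
def dunkl (m : ℕ) (c : ℂ) (y : Fin 2 → ℂ) : Poly →ₗ[ℂ] Poly :=
  (∑ i, y i • (pderiv i).toLinearMap)
    - ∑ j ∈ Finset.range m, (c * ∑ i, y i * rootVec m j i) • diffQuot m j

/-- The constant parameter `c` is *regular*: no polynomial of positive degree is annihilated by
all the Dunkl operators. -/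
def IsRegular (m : ℕ) (c : ℂ) : Prop :=
  ¬ ∃ x : Poly, 0 < x.totalDegree ∧ ∀ y : Fin 2 → ℂ, dunkl m c y x = 0

/-- The operator `∇_{e₂} = ∇_z ∇_{z̄}` attached to the invariant `e₂ = z z̄` of degree 2. -/
def dunklE2 (m : ℕ) (c : ℂ) : Poly →ₗ[ℂ] Poly :=
  dunkl m c ![1, 0] ∘ₗ dunkl m c ![0, 1]

/-- The space of homogeneous quasiharmonic polynomials of degree `n`. The basic invariants of
`I₂(m)` have degrees `2` and `m` (the Coxeter number), so that for `m ≥ 3` quasiharmonicity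
is the single condition `∇_{e₂} f = 0`. -/
def quasiharmonics (m : ℕ) (c : ℂ) (n : ℕ) : Submodule ℂ Poly :=
  homogeneousSubmodule (Fin 2) ℂ n ⊓ LinearMap.ker (dunklE2 m c)

/-- The ideal `J_{n,c}` generated by the quasiharmonic polynomials of degree `n`. -/
def quasiharmonicIdeal (m : ℕ) (c : ℂ) (n : ℕ) : Ideal Poly :=
  Ideal.span (quasiharmonics m c n : Set Poly)

/-- The image in `ℂ[z, z̄] / J` of the space of homogeneous polynomials of degree `k`. -/
def quotientComponent (J : Ideal Poly) (k : ℕ) : Submodule ℂ (Poly ⧸ J) :=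
  (homogeneousSubmodule (Fin 2) ℂ k).map (Ideal.Quotient.mkₐ ℂ J).toLinearMap

/-- A commutative algebra `A` with the family of subspaces `𝒜 k` is a *standard Frobenius algebra*
of degree `N`: it is a finite-dimensional graded algebra `A = ⊕_{k=0}^N 𝒜 k` with `dim 𝒜 0 = 1`,
generated by `𝒜 1`, and `(a, b) ↦ pr_N (a b)` is a nondegenerate bilinear form on `A`
(in particular its space of values `𝒜 N` is one-dimensional; the form is symmetric). -/
def IsStandardFrobenius {A : Type*} [CommRing A] [Algebra ℂ A] (𝒜 : ℕ → Submodule ℂ A)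
    (N : ℕ) : Prop :=
  ∃ _ : GradedAlgebra 𝒜,
    FiniteDimensional ℂ A ∧
    (∀ k, N < k → 𝒜 k = ⊥) ∧
    Module.finrank ℂ (𝒜 0) = 1 ∧
    Algebra.adjoin ℂ (𝒜 1 : Set A) = ⊤ ∧
    Module.finrank ℂ (𝒜 N) = 1 ∧
    ∀ a : A, (∀ b : A, GradedAlgebra.proj 𝒜 N (a * b) = 0) → a = 0

/-- The standard pairing between `S(V*)` (polynomials `p` in the basis dual to `z, z̄`) and
`S(V)`, under which `p` acts as a differential operator with constant coefficients evaluated at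
`0`: distinct monomials are orthogonal and
`⟨z^a z̄^b, z^a z̄^b⟩ = a! b!`. -/
def pairing (p u : Poly) : ℂ :=
  ∑ d ∈ p.support, (∏ i, ((d i).factorial : ℂ)) * coeff d p * coeff d u

/-- `p` is a characteristic polynomial of degree `N` of (the algebra `ℂ[z, z̄] / J` defined by)
the ideal `J`: a homogeneous polynomial of degree `N` on `V` such that the degree-`N` component
of `J` is the kernel of the linear functional `⟨p, ·⟩` on `S^N(V)`. It is unique up to a nonzero
scalar multiple whenever that component has codimension one. -/
def IsCharacteristicPolynomial (J : Ideal Poly) (N : ℕ) (p : Poly) : Prop :=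
  p.IsHomogeneous N ∧ ∀ u : Poly, u.IsHomogeneous N → (u ∈ J ↔ pairing p u = 0)

/-- The divided-power monomial `z^{(a)} z̄^{(b)}`, where `x^{(a)} = x^a / a!`. -/
def dividedMonomial (a b : ℕ) : Poly :=
  C (1 / ((a.factorial : ℂ) * (b.factorial : ℂ))) * (X 0 ^ a * X 1 ^ b)

/-- `z^{(a;b)} = z^{(a)} z̄^{(b)} + z^{(b)} z̄^{(a)}`. -/
def symMonomial (a b : ℕ) : Poly := dividedMonomial a b + dividedMonomial b a

end DihedralCherednik

end

/-! Formally, let `φ = phi m c` be the normalised integral over the unit circle against the weight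
|∏ⱼ αⱼ|^{-2c}. Its moments on `z^a z̄^b` are the coefficients of the claimed polynomial. The proof
never integrates: `φ` is defined by these moments, which make sense for every `c`, and each property
needed follows from the recurrence of the ratio c⋯(c+k-1)/((1-c)⋯(k-c)). The excluded values of `c`
are those where a denominator among the moments of index at most `2n` vanishes.

`φ` is invariant under reflections and under multiplication by `e₂ = z z̄`. Two facts make it an
integral for Dunkl operators: they obey the ordinary Leibniz rule under `φ` (`phi_dunklZ_mul`,
`phi_dunklZbar_mul`), and `φ(∇_z u)` is an explicit multiple of `φ(z̄ u)` in odd degree, with the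
analogue for `∇_{z̄}` (`phi_dunklZ`, `phi_dunklZbar`). Hence for regular `c` the form `φ(fg)` is
nondegenerate in each degree up to `n` (`eq_zero_of_phi_mul_eq_zero`). Green's formula makes
quasiharmonics of degree `n + 1` orthogonal to degree `n - 1`, provided `cm` avoids the integers `n
- i` with `2i + 1 ≤ n` (`phi_mul_eq_zero`).

For regular `c` these integers are avoided, since each would make `c` excluded or singular. Both the
quasiharmonics and the annihilator of degree `n - 1` inside degree `n + 1` have dimension 2, so they
coincide. As the annihilator ideal of `φ` in degree `2n` has no elements in degrees at most `n` and
is generated in degree `n + 1` (`exists_mem_momentIdeal_eq`), it equals `J`, and the quotient by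
such an ideal is Frobenius.

For the characteristic polynomial only the inclusion of `J` in this annihilator is needed, and the
Frobenius property replaces regularity: at an exceptional `cm` the space of quasiharmonics is
degenerate in a way that contradicts it (`mul_ne_of_isStandardFrobenius`). In degree `2n` both
ideals then have codimension one, so they agree there, and pairing with the claimed polynomial is
`φ` itself (`pairing_charPoly`). -/

noncomputable section

namespace DihedralCherednik

/-! ### Monomials in two variables -/

/-- The monomial `z^a z̄^b`. -/
abbrev mono (a b : ℕ) : Poly := X 0 ^ a * X 1 ^ b

/-- The exponent vector of `z^a z̄^b`. -/
def expo (a b : ℕ) : Fin 2 →₀ ℕ := Finsupp.single 0 a + Finsupp.single 1 b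

@[simp] theorem expo_zero (a b : ℕ) : expo a b 0 = a := by simp [expo]

@[simp] theorem expo_one (a b : ℕ) : expo a b 1 = b := by simp [expo]

theorem expo_eta (d : Fin 2 →₀ ℕ) : expo (d 0) (d 1) = d := by
  ext i; fin_cases i <;> simp

theorem expo_injective {a b a' b' : ℕ} (h : expo a b = expo a' b') : a = a' ∧ b = b' :=
  ⟨by simpa using DFunLike.congr_fun h 0, by simpa using DFunLike.congr_fun h 1⟩

theorem mono_eq_monomial (a b : ℕ) : mono a b = monomial (expo a b) 1 := by
  rw [mono, X_pow_eq_monomial, X_pow_eq_monomial, monomial_mul, one_mul, expo]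

theorem poly_induction {P : Poly → Prop} (hadd : ∀ f g, P f → P g → P (f + g))
    (hmono : ∀ (r : ℂ) a b, P (r • mono a b)) (f : Poly) : P f := by
  induction f using MvPolynomial.induction_on' with
  | monomial d r =>
    have := hmono r (d 0) (d 1)
    rwa [mono_eq_monomial, expo_eta, smul_monomial, smul_eq_mul, mul_one] at this
  | add f g hf hg => exact hadd f g hf hg

/-- Linear maps on `ℂ[z, z̄]` agreeing on monomials are equal. -/
theorem linearMap_ext {M : Type*} [AddCommMonoid M] [Module ℂ M] {S T : Poly →ₗ[ℂ] M}
    (h : ∀ a b, S (mono a b) = T (mono a b)) : S = T := by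
  refine LinearMap.ext fun f => ?_
  induction f using poly_induction with
  | hadd f g hf hg => simp [hf, hg]
  | hmono r a b => simp only [map_smul, h]

/-- The span of the monomials `z^a z̄^(k-a)` with `a ∈ s`. -/
def binaryForms (k : ℕ) (s : Finset ℕ) : Submodule ℂ Poly :=
  Submodule.span ℂ ((fun a => mono a (k - a)) '' (s : Set ℕ))

theorem mono_mem_binaryForms {k : ℕ} {s : Finset ℕ} {a b : ℕ} (ha : a ∈ s) (hk : a + b = k) :
    mono a b ∈ binaryForms k s := by
  obtain rfl : b = k - a := by omega
  exact Submodule.subset_span ⟨a, ha, rfl⟩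

theorem map_mem_of_binaryForms {k : ℕ} {s : Finset ℕ} (hs : s ⊆ Finset.range (k + 1))
    {W : Submodule ℂ Poly} (T : Poly →ₗ[ℂ] Poly)
    (h : ∀ a b, a ∈ s → a + b = k → T (mono a b) ∈ W) {f : Poly} (hf : f ∈ binaryForms k s) :
    T f ∈ W := by
  have : binaryForms k s ≤ W.comap T := by
    refine Submodule.span_le.2 ?_
    rintro _ ⟨a, ha, rfl⟩
    have := Finset.mem_range.1 (hs ha)
    exact h a (k - a) ha (by omega)
  exact this hf

theorem linearIndependent_mono (k : ℕ) : LinearIndependent ℂ (fun a : ℕ => mono a (k - a)) := by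
  have h := (basisMonomials (Fin 2) ℂ).linearIndependent.comp (fun a : ℕ => expo a (k - a))
    (fun a b h => (expo_injective h).1)
  have he : (fun a : ℕ => mono a (k - a)) =
      basisMonomials (Fin 2) ℂ ∘ fun a : ℕ => expo a (k - a) := by
    funext a
    simp [mono_eq_monomial]
  rw [he]
  exact h

theorem finrank_binaryForms (k : ℕ) (s : Finset ℕ) :
    Module.finrank ℂ (binaryForms k s) = s.card := by
  have h := (linearIndependent_mono k).comp (fun a : s => (a : ℕ)) Subtype.val_injective
  have h2 := finrank_span_eq_card h
  rw [Fintype.card_coe] at h2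
  rw [Set.range_comp, Subtype.range_coe_subtype, Finset.setOfPred_mem] at h2
  exact h2

instance (k : ℕ) (s : Finset ℕ) : FiniteDimensional ℂ (binaryForms k s) :=
  FiniteDimensional.span_of_finite ℂ (s.finite_toSet.image _)

theorem mono_isHomogeneous (a b : ℕ) : (mono a b).IsHomogeneous (a + b) :=
  (isHomogeneous_X_pow _ _).mul (isHomogeneous_X_pow _ _)

theorem binaryForms_le_homogeneousSubmodule {k : ℕ} {s : Finset ℕ}
    (hs : s ⊆ Finset.range (k + 1)) : binaryForms k s ≤ homogeneousSubmodule (Fin 2) ℂ k := by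
  refine Submodule.span_le.2 ?_
  rintro _ ⟨a, ha, rfl⟩
  have := Finset.mem_range.1 (hs ha)
  have h := mono_isHomogeneous a (k - a)
  rwa [show a + (k - a) = k by omega] at h

theorem homogeneousSubmodule_eq_binaryForms (k : ℕ) :
    homogeneousSubmodule (Fin 2) ℂ k = binaryForms k (Finset.range (k + 1)) := by
  refine le_antisymm (fun f hf => ?_) (binaryForms_le_homogeneousSubmodule subset_rfl)
  rw [← f.support_sum_monomial_coeff]
  refine Submodule.sum_mem _ fun d hd => ?_
  have hdeg : d 0 + d 1 = k := by
    have := ((mem_homogeneousSubmodule _ _).1 hf).degree_eq_sum_deg_support hd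
    rw [this, ← Fin.sum_univ_two (f := d)]
    exact (Finset.sum_subset (Finset.subset_univ _) (by simp)).symm
  have := Submodule.smul_mem _ (coeff d f)
    (mono_mem_binaryForms (s := Finset.range (k + 1)) (Finset.mem_range.2 (by omega)) hdeg)
  rwa [mono_eq_monomial, expo_eta, smul_monomial, smul_eq_mul, mul_one] at this

theorem finrank_homogeneousSubmodule (k : ℕ) :
    Module.finrank ℂ (homogeneousSubmodule (Fin 2) ℂ k) = k + 1 := by
  rw [homogeneousSubmodule_eq_binaryForms, finrank_binaryForms, Finset.card_range]

instance (k : ℕ) : FiniteDimensional ℂ (homogeneousSubmodule (Fin 2) ℂ k) := by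
  rw [homogeneousSubmodule_eq_binaryForms]; infer_instance

theorem map_mem_of_isHomogeneous {k : ℕ} {W : Submodule ℂ Poly} (T : Poly →ₗ[ℂ] Poly)
    (h : ∀ a b, a + b = k → T (mono a b) ∈ W) {f : Poly} (hf : f.IsHomogeneous k) :
    T f ∈ W := by
  rw [← mem_homogeneousSubmodule, homogeneousSubmodule_eq_binaryForms] at hf
  exact map_mem_of_binaryForms subset_rfl T (fun a b _ => h a b) hf

theorem map_eq_of_isHomogeneous {k : ℕ} {M : Type*} [AddCommGroup M] [Module ℂ M]
    (S T : Poly →ₗ[ℂ] M) (h : ∀ a b, a + b = k → S (mono a b) = T (mono a b)) {f : Poly}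
    (hf : f.IsHomogeneous k) : S f = T f := by
  rw [← mem_homogeneousSubmodule, homogeneousSubmodule_eq_binaryForms] at hf
  have : binaryForms k (Finset.range (k + 1)) ≤ LinearMap.eqLocus S T := by
    refine Submodule.span_le.2 ?_
    rintro _ ⟨a, ha, rfl⟩
    have := Finset.mem_range.1 (Finset.mem_coe.1 ha)
    exact h a (k - a) (by omega)
  exact this hf

/-- A linear map from a space of dimension `≥ dim W + k` to `W` has kernel of dimension `≥ k`. -/
theorem le_finrank_inf_ker {V W : Submodule ℂ Poly} [FiniteDimensional ℂ V]
    [FiniteDimensional ℂ W] (T : Poly →ₗ[ℂ] Poly) (h : ∀ f ∈ V, T f ∈ W) {k : ℕ}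
    (hk : Module.finrank ℂ W + k ≤ Module.finrank ℂ V) :
    k ≤ Module.finrank ℂ (V ⊓ LinearMap.ker T : Submodule ℂ Poly) := by
  have h1 := LinearMap.finrank_range_add_finrank_ker (T.domRestrict V)
  have h2 : Module.finrank ℂ (LinearMap.range (T.domRestrict V)) ≤ Module.finrank ℂ W := by
    refine Submodule.finrank_mono ?_
    rintro _ ⟨f, rfl⟩
    exact h f f.2
  have h3 : Module.finrank ℂ (LinearMap.ker (T.domRestrict V)) ≤
      Module.finrank ℂ (V ⊓ LinearMap.ker T : Submodule ℂ Poly) := by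
    rw [← Submodule.finrank_map_subtype_eq V]
    refine Submodule.finrank_mono ?_
    rintro _ ⟨f, hf, rfl⟩
    exact ⟨f.2, hf⟩
  omega

/-! ### Reflections and difference quotients -/

theorem reflection_mono (m j a b : ℕ) :
    reflection m j (mono a b) = ((-1) ^ (a + b) * (zeta m ^ j) ^ ((a : ℤ) - b)) • mono b a := by
  have hz := zeta_pow_ne_zero m j
  simp only [mono, reflection, map_mul, map_pow, aeval_X, Matrix.cons_val_zero,
    Matrix.cons_val_one, zpow_sub₀ hz, zpow_natCast, smul_eq_C_mul, div_eq_mul_inv, ← inv_pow]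
  rw [neg_pow (C (zeta m) ^ j * X 1 : Poly), neg_pow (C (zeta m)⁻¹ ^ j * X 0 : Poly),
    mul_pow, mul_pow]
  simp only [C_neg, C_1, pow_add]
  ring

theorem reflection_root (m j : ℕ) : reflection m j (root m j) = -root m j := by
  have h2 : (C (zeta m ^ j) : Poly) * C ((zeta m ^ j)⁻¹) = 1 := by
    rw [← C_mul, mul_inv_cancel₀ (zeta_pow_ne_zero m j), C_1]
  simp only [root_eq, reflection, map_add, map_mul, aeval_X, algHom_C, algebraMap_eq,
    Matrix.cons_val_zero, Matrix.cons_val_one]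
  linear_combination (-X 0 : Poly) * h2

theorem reflection_reflection (m j : ℕ) (f : Poly) : reflection m j (reflection m j f) = f := by
  suffices h : (reflection m j).comp (reflection m j) = AlgHom.id ℂ _ from DFunLike.congr_fun h f
  have h2 : (C (zeta m ^ j) : Poly) * C ((zeta m ^ j)⁻¹) = 1 := by
    rw [← C_mul, mul_inv_cancel₀ (zeta_pow_ne_zero m j), C_1]
  apply MvPolynomial.algHom_ext
  intro i
  fin_cases i
  · simp only [reflection, AlgHom.comp_apply, aeval_X, Fin.zero_eta, Matrix.cons_val_zero, map_neg,
      map_mul, algHom_C, algebraMap_eq, Matrix.cons_val_one, AlgHom.id_apply]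
    linear_combination (X 0 : Poly) * h2
  · simp only [reflection, AlgHom.comp_apply, aeval_X, Fin.mk_one, Matrix.cons_val_zero, map_neg,
      map_mul, algHom_C, algebraMap_eq, Matrix.cons_val_one, AlgHom.id_apply]
    linear_combination (X 1 : Poly) * h2

/-- Numerator and denominator of the difference quotient both change sign under the reflection. -/
theorem reflection_diffQuot (m j : ℕ) (f : Poly) :
    reflection m j (diffQuot m j f) = diffQuot m j f := by
  apply mul_left_cancel₀ (root_ne_zero m j)
  have h := congrArg (reflection m j) (root_mul_diffQuot m j f)
  rw [map_mul, reflection_root, map_sub, reflection_reflection] at h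
  rw [root_mul_diffQuot]
  linear_combination -h

theorem diffQuot_mul (m j : ℕ) (f g : Poly) :
    diffQuot m j (f * g) = diffQuot m j f * g + reflection m j f * diffQuot m j g := by
  apply mul_left_cancel₀ (root_ne_zero m j)
  rw [root_mul_diffQuot, map_mul]
  linear_combination (-g) * root_mul_diffQuot m j f
    - (reflection m j f) * root_mul_diffQuot m j g

theorem diffQuot_X_zero (m j : ℕ) : diffQuot m j (X 0) = 1 := by
  apply mul_left_cancel₀ (root_ne_zero m j)
  rw [root_mul_diffQuot]
  simp [reflection, root_eq]

theorem diffQuot_X_one (m j : ℕ) : diffQuot m j (X 1) = C ((zeta m ^ j)⁻¹) := by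
  apply mul_left_cancel₀ (root_ne_zero m j)
  have h2 : (C (zeta m ^ j) : Poly) * C ((zeta m ^ j)⁻¹) = 1 := by
    rw [← C_mul, mul_inv_cancel₀ (zeta_pow_ne_zero m j), C_1]
  rw [root_mul_diffQuot]
  simp only [reflection, root_eq, aeval_X, Matrix.cons_val_one, Matrix.cons_val_zero]
  linear_combination (-X 1 : Poly) * h2

/-- The invariant `(z z̄)^b` factors out, and what remains is the geometric sum for `(z^d - (-ζ^j
z̄)^d) / (z + ζ^j z̄)`. -/
theorem diffQuot_mono (m j b d : ℕ) :
    diffQuot m j (mono (b + d) b) =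
      ∑ i ∈ Finset.range d, (-(zeta m ^ j)) ^ i • mono (b + (d - 1 - i)) (b + i) := by
  apply mul_left_cancel₀ (root_ne_zero m j)
  have hg := (Commute.all (-(C (zeta m ^ j) * X 1) : Poly) (X 0)).mul_geom_sum₂ d
  have hr : reflection m j (mono (b + d) b) = mono b b * (-(C (zeta m ^ j) * X 1)) ^ d := by
    have h0 : reflection m j (X 0 * X 1) = X 0 * X 1 := by
      have h2 : (C (zeta m ^ j) : Poly) * C ((zeta m ^ j)⁻¹) = 1 := by
        rw [← C_mul, mul_inv_cancel₀ (zeta_pow_ne_zero m j), C_1]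
      simp only [reflection, map_mul, aeval_X, Matrix.cons_val_one, Matrix.cons_val_zero]
      linear_combination (X 1 * X 0 : Poly) * h2
    have h1 : mono (b + d) b = (X 0 * X 1) ^ b * X 0 ^ d := by simp only [mono]; ring
    rw [h1, map_mul, map_pow, h0, map_pow]
    simp only [mono, reflection, aeval_X, Matrix.cons_val_zero]
    ring
  have hs : ∑ i ∈ Finset.range d, (-(zeta m ^ j)) ^ i • mono (b + (d - 1 - i)) (b + i) =
      mono b b * ∑ i ∈ Finset.range d, (-(C (zeta m ^ j) * X 1) : Poly) ^ i * X 0 ^ (d - 1 - i) := by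
    rw [Finset.mul_sum]
    refine Finset.sum_congr rfl fun i _ => ?_
    rw [smul_eq_C_mul, C_pow, C_neg, neg_mul_eq_neg_mul, mul_pow]
    simp only [mono]
    ring
  rw [root_mul_diffQuot, hr, hs, root_eq]
  have h1 : mono (b + d) b = mono b b * X 0 ^ d := by simp only [mono]; ring
  rw [h1]
  linear_combination (mono b b) * hg

/-- The reflection exchanges the two monomials up to a scalar, and difference quotients change sign
when their argument is reflected. -/
theorem diffQuot_mono_swap (m j a d : ℕ) :
    diffQuot m j (mono a (a + d)) =
      -(((-1) ^ d * (zeta m ^ j) ^ (-(d : ℤ))) • diffQuot m j (mono (a + d) a)) := by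
  have h : reflection m j (mono a (a + d)) =
      ((-1) ^ d * (zeta m ^ j) ^ (-(d : ℤ))) • mono (a + d) a := by
    rw [reflection_mono]
    congr 2
    · rw [← add_assoc, pow_add, Even.neg_one_pow ⟨a, rfl⟩, one_mul]
    · congr 1; push_cast; ring
  rw [← map_smul, ← h]
  apply mul_left_cancel₀ (root_ne_zero m j)
  rw [mul_neg, root_mul_diffQuot, root_mul_diffQuot, reflection_reflection]
  ring

/-! ### The Dunkl operators on monomials -/

theorem sum_zeta_zpow {m : ℕ} (hm : m ≠ 0) (x : ℤ) :
    ∑ j ∈ Finset.range m, (zeta m ^ j) ^ x = if (m : ℤ) ∣ x then (m : ℂ) else 0 := by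
  have hprim : IsPrimitiveRoot (zeta m) m := Complex.isPrimitiveRoot_exp m hm
  have h0 : ∀ j : ℕ, (zeta m ^ j) ^ x = (zeta m ^ x) ^ j := fun j => by
    rw [← zpow_natCast, ← zpow_mul, mul_comm, zpow_mul, zpow_natCast]
  simp only [h0]
  split_ifs with h
  · simp [(hprim.zpow_eq_one_iff_dvd x).2 h]
  · have h1 : zeta m ^ x ≠ 1 := fun h' => h ((hprim.zpow_eq_one_iff_dvd x).1 h')
    have h2 : (zeta m ^ x) ^ m = 1 := by
      rw [← zpow_natCast, ← zpow_mul, mul_comm, zpow_mul, zpow_natCast, hprim.pow_eq_one, one_zpow]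
    rw [geom_sum_eq h1, h2, sub_self, zero_div]

/-- The weighted sum `∑ⱼ ζ^{je} (1 - sⱼ)/αⱼ` of difference quotients. -/
def diffSum (m : ℕ) (e : ℤ) : Poly →ₗ[ℂ] Poly :=
  ∑ j ∈ Finset.range m, ((zeta m ^ j) ^ e) • diffQuot m j

theorem diffSum_apply (m : ℕ) (e : ℤ) (f : Poly) :
    diffSum m e f = ∑ j ∈ Finset.range m, ((zeta m ^ j) ^ e) • diffQuot m j f := by
  simp [diffSum]

theorem diffSum_mono {m : ℕ} (hm : m ≠ 0) (e : ℤ) (b d : ℕ) :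
    diffSum m e (mono (b + d) b) = ∑ i ∈ Finset.range d,
      ((if (m : ℤ) ∣ e + i then (m : ℂ) else 0) * (-1) ^ i) • mono (b + (d - 1 - i)) (b + i) := by
  rw [diffSum_apply]
  simp only [diffQuot_mono, Finset.smul_sum]
  rw [Finset.sum_comm]
  refine Finset.sum_congr rfl fun i _ => ?_
  rw [← sum_zeta_zpow hm, Finset.sum_mul, Finset.sum_smul]
  refine Finset.sum_congr rfl fun j _ => ?_
  rw [smul_smul, zpow_add₀ (zeta_pow_ne_zero m j), zpow_natCast, neg_pow (zeta m ^ j)]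
  congr 1
  ring

theorem diffSum_mono_swap (m : ℕ) (e : ℤ) (a d : ℕ) :
    diffSum m e (mono a (a + d)) = -((-1 : ℂ) ^ d • diffSum m (e - d) (mono (a + d) a)) := by
  rw [diffSum_apply, diffSum_apply, Finset.smul_sum, ← Finset.sum_neg_distrib]
  refine Finset.sum_congr rfl fun j _ => ?_
  rw [diffQuot_mono_swap, smul_neg, smul_smul, sub_eq_add_neg,
    zpow_add₀ (zeta_pow_ne_zero m j)]
  rcases neg_one_pow_eq_or ℂ d with h | h <;> rcases Nat.even_or_odd d with h' | h' <;>
    simp [h'.neg_one_pow]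

/-- The Dunkl operator `∇_z`. -/
def dunklZ (m : ℕ) (c : ℂ) : Poly →ₗ[ℂ] Poly := (pderiv 0).toLinearMap - c • diffSum m 0

/-- The Dunkl operator `∇_{z̄}`. -/
def dunklZbar (m : ℕ) (c : ℂ) : Poly →ₗ[ℂ] Poly := (pderiv 1).toLinearMap - c • diffSum m 1

theorem dunklZ_apply (m : ℕ) (c : ℂ) (f : Poly) :
    dunklZ m c f = pderiv 0 f - C c * diffSum m 0 f := by
  rw [← smul_eq_C_mul]; rfl

theorem dunklZbar_apply (m : ℕ) (c : ℂ) (f : Poly) :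
    dunklZbar m c f = pderiv 1 f - C c * diffSum m 1 f := by
  rw [← smul_eq_C_mul]; rfl

theorem dunkl_eq (m : ℕ) (c : ℂ) (y : Fin 2 → ℂ) :
    dunkl m c y = y 0 • dunklZ m c + y 1 • dunklZbar m c := by
  refine LinearMap.ext fun f => ?_
  simp only [dunkl, dunklZ, dunklZbar, diffSum_apply, LinearMap.sub_apply, LinearMap.add_apply,
    LinearMap.smul_apply, LinearMap.sum_apply, Fin.sum_univ_two, rootVec, Matrix.cons_val_zero,
    Matrix.cons_val_one, zpow_zero, one_smul, zpow_one, mul_one, smul_sub, Finset.smul_sum,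
    smul_smul, mul_add, add_smul, Finset.sum_add_distrib]
  simp only [mul_comm, mul_left_comm]
  abel

theorem dunklE2_eq (m : ℕ) (c : ℂ) : dunklE2 m c = dunklZ m c ∘ₗ dunklZbar m c := by
  simp [dunklE2, dunkl_eq]

/-! ### Rotation weights: exponents modulo `m` -/

/-- The exponents `a ≤ k` congruent to `x` modulo `m`. -/
def residueClass (m k : ℕ) (x : ℤ) : Finset ℕ :=
  (Finset.range (k + 1)).filter fun a => (m : ℤ) ∣ a - x

theorem mem_residueClass {m k : ℕ} {x : ℤ} {a : ℕ} :
    a ∈ residueClass m k x ↔ a < k + 1 ∧ (m : ℤ) ∣ a - x := by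
  simp [residueClass]

theorem residueClass_subset (m k : ℕ) (x : ℤ) : residueClass m k x ⊆ Finset.range (k + 1) :=
  Finset.filter_subset _ _

theorem diffSum_mono_self {m : ℕ} (hm : m ≠ 0) (e : ℤ) (a : ℕ) :
    diffSum m e (mono a a) = 0 := by
  simpa using diffSum_mono hm e a 0

/-- Summing over all roots of unity leaves only terms of one residue modulo `m`. Thus Dunkl
operators respect the grading by exponents of `z` modulo `m`, which later allows kernel dimensions
to be counted class by class. -/
theorem diffSum_mono_mem {m : ℕ} (hm : m ≠ 0) (e : ℤ) {k a b : ℕ} (hk : a + b = k + 1) {x : ℤ}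
    (hx : (m : ℤ) ∣ a - x) :
    diffSum m e (mono a b) ∈ binaryForms k (residueClass m k (x + e - 1)) := by
  rcases le_total b a with h | h
  · obtain ⟨d, rfl⟩ := Nat.exists_eq_add_of_le h
    rw [diffSum_mono hm e b d]
    refine Submodule.sum_mem _ fun i hi => ?_
    have hi := Finset.mem_range.1 hi
    split_ifs with hd
    · refine Submodule.smul_mem _ _ (mono_mem_binaryForms (mem_residueClass.2 ⟨by omega, ?_⟩)
        (by omega))
      rw [show ((b + (d - 1 - i) : ℕ) : ℤ) - (x + e - 1) = (((b + d : ℕ) : ℤ) - x) - (e + i) by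
        omega]
      exact dvd_sub hx hd
    · simp
  · obtain ⟨d, rfl⟩ := Nat.exists_eq_add_of_le h
    rw [diffSum_mono_swap m e a d, diffSum_mono hm (e - d) a d]
    refine Submodule.neg_mem _ (Submodule.smul_mem _ _ ?_)
    refine Submodule.sum_mem _ fun i hi => ?_
    have hi := Finset.mem_range.1 hi
    split_ifs with hd
    · refine Submodule.smul_mem _ _ (mono_mem_binaryForms (mem_residueClass.2 ⟨by omega, ?_⟩)
        (by omega))
      rw [show ((a + (d - 1 - i) : ℕ) : ℤ) - (x + e - 1) = ((a : ℤ) - x) - (e - d + i) by omega]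
      exact dvd_sub hx hd
    · simp

theorem pderiv_zero_mono (a b : ℕ) : pderiv 0 (mono a b) = (a : ℂ) • mono (a - 1) b := by
  simp [mono, Derivation.leibniz_pow, smul_eq_C_mul, pderiv_X, Derivation.leibniz]
  ring

theorem pderiv_one_mono (a b : ℕ) : pderiv 1 (mono a b) = (b : ℂ) • mono a (b - 1) := by
  simp [mono, Derivation.leibniz_pow, smul_eq_C_mul, pderiv_X, Derivation.leibniz]
  ring

theorem dunklZ_mono (m : ℕ) (c : ℂ) (a b : ℕ) :
    dunklZ m c (mono a b) = (a : ℂ) • mono (a - 1) b - c • diffSum m 0 (mono a b) := by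
  rw [← pderiv_zero_mono]; rfl

theorem dunklZbar_mono (m : ℕ) (c : ℂ) (a b : ℕ) :
    dunklZbar m c (mono a b) = (b : ℂ) • mono a (b - 1) - c • diffSum m 1 (mono a b) := by
  rw [← pderiv_one_mono]; rfl

theorem dunklZ_mono_mem {m : ℕ} (hm : m ≠ 0) (c : ℂ) {k a b : ℕ} (hk : a + b = k + 1) {x : ℤ}
    (hx : (m : ℤ) ∣ a - x) :
    dunklZ m c (mono a b) ∈ binaryForms k (residueClass m k (x - 1)) := by
  rw [dunklZ_mono]
  refine Submodule.sub_mem _ ?_ (Submodule.smul_mem _ _ ?_)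
  · rcases Nat.eq_zero_or_pos a with rfl | ha
    · simp
    · refine Submodule.smul_mem _ _ (mono_mem_binaryForms (mem_residueClass.2 ⟨by omega, ?_⟩)
        (by omega))
      convert hx using 1
      push_cast [ha]
      ring
  · simpa using diffSum_mono_mem hm 0 hk hx

theorem dunklZbar_mono_mem {m : ℕ} (hm : m ≠ 0) (c : ℂ) {k a b : ℕ} (hk : a + b = k + 1) {x : ℤ}
    (hx : (m : ℤ) ∣ a - x) :
    dunklZbar m c (mono a b) ∈ binaryForms k (residueClass m k x) := by
  rw [dunklZbar_mono]
  refine Submodule.sub_mem _ ?_ (Submodule.smul_mem _ _ ?_)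
  · rcases Nat.eq_zero_or_pos b with rfl | hb
    · simp
    · exact Submodule.smul_mem _ _ (mono_mem_binaryForms (mem_residueClass.2 ⟨by omega, hx⟩)
        (by omega))
  · simpa using diffSum_mono_mem hm 1 hk hx

theorem dunklZ_mem {m : ℕ} (hm : m ≠ 0) (c : ℂ) {k : ℕ} {x : ℤ} {f : Poly}
    (hf : f ∈ binaryForms (k + 1) (residueClass m (k + 1) x)) :
    dunklZ m c f ∈ binaryForms k (residueClass m k (x - 1)) :=
  map_mem_of_binaryForms (residueClass_subset _ _ _) _
    (fun _ _ ha hk => dunklZ_mono_mem hm c hk (mem_residueClass.1 ha).2) hf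

theorem dunklZbar_mem {m : ℕ} (hm : m ≠ 0) (c : ℂ) {k : ℕ} {x : ℤ} {f : Poly}
    (hf : f ∈ binaryForms (k + 1) (residueClass m (k + 1) x)) :
    dunklZbar m c f ∈ binaryForms k (residueClass m k x) :=
  map_mem_of_binaryForms (residueClass_subset _ _ _) _
    (fun _ _ ha hk => dunklZbar_mono_mem hm c hk (mem_residueClass.1 ha).2) hf

theorem dunklZ_isHomogeneous {m : ℕ} (hm : m ≠ 0) (c : ℂ) {k : ℕ} {f : Poly}
    (hf : f.IsHomogeneous (k + 1)) : (dunklZ m c f).IsHomogeneous k :=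
  map_mem_of_isHomogeneous (W := homogeneousSubmodule (Fin 2) ℂ k) _
    (fun a _ hk => binaryForms_le_homogeneousSubmodule (residueClass_subset _ _ _)
      (dunklZ_mono_mem hm c hk (x := a) (by simp))) hf

theorem dunklZbar_isHomogeneous {m : ℕ} (hm : m ≠ 0) (c : ℂ) {k : ℕ} {f : Poly}
    (hf : f.IsHomogeneous (k + 1)) : (dunklZbar m c f).IsHomogeneous k :=
  map_mem_of_isHomogeneous (W := homogeneousSubmodule (Fin 2) ℂ k) _
    (fun a _ hk => binaryForms_le_homogeneousSubmodule (residueClass_subset _ _ _)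
      (dunklZbar_mono_mem hm c hk (x := a) (by simp))) hf

theorem dunklZ_eq_zero {m : ℕ} (hm : m ≠ 0) (c : ℂ) {f : Poly} (hf : f.IsHomogeneous 0) :
    dunklZ m c f = 0 := by
  refine map_eq_of_isHomogeneous (dunklZ m c) 0 (fun a b h => ?_) hf
  obtain ⟨rfl, rfl⟩ : a = 0 ∧ b = 0 := by omega
  simp [dunklZ_mono, diffSum_mono_self hm]

theorem dunklZbar_eq_zero {m : ℕ} (hm : m ≠ 0) (c : ℂ) {f : Poly} (hf : f.IsHomogeneous 0) :
    dunklZbar m c f = 0 := by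
  refine map_eq_of_isHomogeneous (dunklZbar m c) 0 (fun a b h => ?_) hf
  obtain ⟨rfl, rfl⟩ : a = 0 ∧ b = 0 := by omega
  simp [dunklZbar_mono, diffSum_mono_self hm]

/-! ### Commutation relations -/

/-- The sum of the reflections of `I₂(m)`. -/
def reflectionSum (m : ℕ) : Poly →ₗ[ℂ] Poly :=
  ∑ j ∈ Finset.range m, (reflection m j).toLinearMap

theorem reflectionSum_apply (m : ℕ) (f : Poly) :
    reflectionSum m f = ∑ j ∈ Finset.range m, reflection m j f := by
  simp [reflectionSum]

theorem euler {k : ℕ} {f : Poly} (hf : f.IsHomogeneous k) :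
    X 0 * pderiv 0 f + X 1 * pderiv 1 f = (k : ℂ) • f := by
  have := hf.sum_X_mul_pderiv
  rw [Fin.sum_univ_two] at this
  rw [this, Nat.cast_smul_eq_nsmul]

/-- Euler's formula, deformed: contracting a Dunkl operator with the coordinates cancels the
denominator `αⱼ` and leaves `-c ∑ⱼ (1 - sⱼ)`. -/
theorem X_mul_dunkl (m : ℕ) (c : ℂ) {k : ℕ} {f : Poly} (hf : f.IsHomogeneous k) :
    X 0 * dunklZ m c f + X 1 * dunklZbar m c f
      = ((k : ℂ) - c * m) • f + c • reflectionSum m f := by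
  have h : X 0 * diffSum m 0 f + X 1 * diffSum m 1 f = (m : ℂ) • f - reflectionSum m f := by
    rw [diffSum_apply, diffSum_apply, reflectionSum_apply, Finset.mul_sum, Finset.mul_sum,
      ← Finset.sum_add_distrib]
    have : ∀ j ∈ Finset.range m, X 0 * (zeta m ^ j) ^ (0 : ℤ) • diffQuot m j f +
        X 1 * (zeta m ^ j) ^ (1 : ℤ) • diffQuot m j f = f - reflection m j f := fun j _ => by
      rw [← root_mul_diffQuot, root_eq, zpow_zero, zpow_one, one_smul, smul_eq_C_mul]
      ring
    rw [Finset.sum_congr rfl this, Finset.sum_sub_distrib, Finset.sum_const, Finset.card_range,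
      Nat.cast_smul_eq_nsmul]
  have h' := euler hf
  simp only [dunklZ_apply, dunklZbar_apply, smul_eq_C_mul, C_sub, C_mul] at h h' ⊢
  linear_combination h' - C c * h

theorem dunklZ_X_mul (m : ℕ) (c : ℂ) (f : Poly) :
    dunklZ m c (X 0 * f) = X 0 * dunklZ m c f + f - c • reflectionSum m f := by
  have h : diffSum m 0 (X 0 * f) = X 0 * diffSum m 0 f + reflectionSum m f := by
    rw [diffSum_apply, diffSum_apply, reflectionSum_apply, Finset.mul_sum,
      ← Finset.sum_add_distrib]
    refine Finset.sum_congr rfl fun j _ => ?_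
    rw [mul_comm (X 0) f, diffQuot_mul, diffQuot_X_zero, zpow_zero, one_smul, one_smul]
    ring
  simp only [dunklZ_apply, h, smul_eq_C_mul, Derivation.leibniz,
    pderiv_X_self, smul_eq_mul]
  ring

theorem dunklZbar_X_mul (m : ℕ) (c : ℂ) (f : Poly) :
    dunklZbar m c (X 1 * f) = X 1 * dunklZbar m c f + f - c • reflectionSum m f := by
  have h : diffSum m 1 (X 1 * f) = X 1 * diffSum m 1 f + reflectionSum m f := by
    rw [diffSum_apply, diffSum_apply, reflectionSum_apply, Finset.mul_sum,
      ← Finset.sum_add_distrib]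
    refine Finset.sum_congr rfl fun j _ => ?_
    have h2 : (C (zeta m ^ j) : Poly) * C ((zeta m ^ j)⁻¹) = 1 := by
      rw [← C_mul, mul_inv_cancel₀ (zeta_pow_ne_zero m j), C_1]
    rw [mul_comm (X 1) f, diffQuot_mul, diffQuot_X_one, zpow_one, smul_eq_C_mul, smul_eq_C_mul]
    linear_combination (reflection m j f) * h2
  simp only [dunklZbar_apply, h, smul_eq_C_mul, Derivation.leibniz,
    pderiv_X_self, smul_eq_mul]
  ring

/-- Difference quotients are linear over invariants, and `z z̄` is invariant. -/
theorem diffSum_e2_mul (m : ℕ) (e : ℤ) (f : Poly) :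
    diffSum m e (X 0 * X 1 * f) = X 0 * X 1 * diffSum m e f := by
  rw [diffSum_apply, diffSum_apply, Finset.mul_sum]
  refine Finset.sum_congr rfl fun j _ => ?_
  have h2 : (C (zeta m ^ j) : Poly) * C ((zeta m ^ j)⁻¹) = 1 := by
    rw [← C_mul, mul_inv_cancel₀ (zeta_pow_ne_zero m j), C_1]
  have h0 : reflection m j (X 0 * X 1) = X 0 * X 1 := by
    simp only [reflection, map_mul, aeval_X, Matrix.cons_val_one, Matrix.cons_val_zero]
    linear_combination (X 1 * X 0 : Poly) * h2
  have h1 : diffQuot m j (X 0 * X 1) = 0 := by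
    apply mul_left_cancel₀ (root_ne_zero m j)
    rw [root_mul_diffQuot, h0, sub_self, mul_zero]
  rw [diffQuot_mul, h0, h1, zero_mul, zero_add, mul_smul_comm]

theorem dunklZ_e2_mul (m : ℕ) (c : ℂ) (f : Poly) :
    dunklZ m c (X 0 * X 1 * f) = X 0 * X 1 * dunklZ m c f + X 1 * f := by
  simp only [dunklZ_apply, diffSum_e2_mul, Derivation.leibniz,
    pderiv_X_self, smul_eq_mul, pderiv_X_of_ne (show (1 : Fin 2) ≠ 0 by decide)]
  ring

theorem dunklZbar_e2_mul (m : ℕ) (c : ℂ) (f : Poly) :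
    dunklZbar m c (X 0 * X 1 * f) = X 0 * X 1 * dunklZbar m c f + X 0 * f := by
  simp only [dunklZbar_apply, diffSum_e2_mul, Derivation.leibniz,
    pderiv_X_self, smul_eq_mul, pderiv_X_of_ne (show (0 : Fin 2) ≠ 1 by decide)]
  ring

/-- `∇_z∇_{z̄}` commutes with `e₂^k` up to the `𝔰𝔩₂` correction term. -/
theorem dunklE2_e2_pow_mul (m : ℕ) (c : ℂ) {d : ℕ} {g : Poly} (hg : g.IsHomogeneous d)
    (k : ℕ) :
    dunklE2 m c ((X 0 * X 1) ^ (k + 1) * g) = (X 0 * X 1) ^ (k + 1) * dunklE2 m c g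
      + (((k : ℂ) + 1) * ((d : ℂ) + (k + 1) - c * m)) • ((X 0 * X 1) ^ k * g) := by
  have h1 : ∀ f : Poly, dunklE2 m c (X 0 * X 1 * f) = X 0 * X 1 * dunklE2 m c f
      + (X 0 * dunklZ m c f + X 1 * dunklZbar m c f + f - c • reflectionSum m f) := fun f => by
    simp only [dunklE2_eq, LinearMap.comp_apply, dunklZbar_e2_mul, map_add, dunklZ_e2_mul,
      dunklZ_X_mul]
    ring
  -- The deformed Euler formula cancels the sum of reflections, so the commutator with `e₂` is a
  -- scalar in each degree. The induction on `k` adds these scalars up.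
  have h2 : ∀ {e : ℕ} {f : Poly}, f.IsHomogeneous e → dunklE2 m c (X 0 * X 1 * f) =
      X 0 * X 1 * dunklE2 m c f + ((e : ℂ) - c * m + 1) • f := fun hf => by
    rw [h1, X_mul_dunkl m c hf, add_smul _ (1 : ℂ), one_smul]
    abel
  have hhom : ∀ k : ℕ, ((X 0 * X 1) ^ k * g).IsHomogeneous (2 * k + d) := fun k =>
    (((isHomogeneous_X ℂ (0 : Fin 2)).mul (isHomogeneous_X ℂ 1)).pow k).mul hg
  induction k with
  | zero =>
    rw [zero_add, pow_one, h2 hg, pow_zero, one_mul]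
    congr 2
    push_cast; ring
  | succ k ih =>
    rw [pow_succ' _ (k + 1), mul_assoc, h2 (hhom (k + 1)), ih]
    have hr : ((k + 1 : ℕ) + 1 : ℂ) * (d + ((k + 1 : ℕ) + 1) - c * m) =
        (k + 1) * (d + (k + 1) - c * m) + (((2 * (k + 1) + d : ℕ) : ℂ) - c * m + 1) := by
      push_cast; ring
    rw [hr]
    generalize ((k : ℂ) + 1) * (d + (k + 1) - c * m) = u
    generalize ((2 * (k + 1) + d : ℕ) : ℂ) - c * m + 1 = v
    simp only [smul_eq_C_mul, C_add]
    ring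

/-! ### The moment functional -/

/-- The quotient `c(c+1)⋯(c+k-1) / ((1-c)(2-c)⋯(k-c))`. -/
def pochRatio (c : ℂ) (k : ℕ) : ℂ :=
  (∏ i ∈ Finset.Icc 1 k, (c + (i : ℂ) - 1)) / ∏ i ∈ Finset.Icc 1 k, ((i : ℂ) - c)

theorem pochRatio_zero (c : ℂ) : pochRatio c 0 = 1 := by simp [pochRatio]

theorem pochRatio_succ {c : ℂ} {k : ℕ} (h : c ≠ ((k + 1 : ℕ) : ℂ)) :
    ((k + 1 : ℂ) - c) * pochRatio c (k + 1) = (k + c) * pochRatio c k := by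
  have h' : (k + 1 : ℂ) - c ≠ 0 := fun h0 => h (by push_cast; linear_combination -h0)
  rw [pochRatio, pochRatio, Finset.prod_Icc_succ_top (by omega),
    Finset.prod_Icc_succ_top (by omega), mul_div_mul_comm]
  push_cast
  field_simp
  ring

/-- The moments `t` of the weight `|z^m - (-z̄)^m|^{-2c}` on the unit circle. -/
def moment (m : ℕ) (c : ℂ) (x : ℤ) : ℂ :=
  if (2 * m : ℤ) ∣ x then ((-1) ^ m) ^ (x / (2 * m)) * pochRatio c (x / (2 * m)).natAbs else 0

theorem moment_mul {m : ℕ} (hm : m ≠ 0) (c : ℂ) (k : ℤ) :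
    moment m c (2 * m * k) = ((-1) ^ m) ^ k * pochRatio c k.natAbs := by
  rw [moment, if_pos (dvd_mul_right _ _), Int.mul_ediv_cancel_left k (by positivity)]

theorem moment_of_not_dvd {m : ℕ} (c : ℂ) {x : ℤ} (h : ¬ (2 * m : ℤ) ∣ x) : moment m c x = 0 :=
  if_neg h

theorem moment_zero {m : ℕ} (hm : m ≠ 0) (c : ℂ) : moment m c 0 = 1 := by
  simpa [pochRatio_zero] using moment_mul hm c 0

theorem neg_one_pow_zpow_neg (m : ℕ) (k : ℤ) :
    (((-1 : ℂ) ^ m) ^ (-k)) = ((-1) ^ m) ^ k := by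
  rw [zpow_neg, ← inv_zpow, ← inv_pow, inv_neg, inv_one]

theorem moment_neg {m : ℕ} (hm : m ≠ 0) (c : ℂ) (x : ℤ) : moment m c (-x) = moment m c x := by
  by_cases h : (2 * m : ℤ) ∣ x
  · obtain ⟨k, rfl⟩ := h
    rw [← mul_neg, moment_mul hm, moment_mul hm, Int.natAbs_neg, neg_one_pow_zpow_neg]
  · rw [moment_of_not_dvd c h, moment_of_not_dvd c (by rwa [dvd_neg])]

/-- The sum of `pochRatio` over the integers of absolute value at most `k`. -/
def pochSum (c : ℂ) (k : ℕ) : ℂ :=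
  ∑ l ∈ Finset.range (2 * k + 1), pochRatio c ((k : ℤ) - l).natAbs

theorem pochSum_succ (c : ℂ) (k : ℕ) :
    pochSum c (k + 1) = pochSum c k + 2 * pochRatio c (k + 1) := by
  rw [pochSum, pochSum, show 2 * (k + 1) + 1 = 2 * k + 1 + 1 + 1 by ring, Finset.sum_range_succ,
    Finset.sum_range_succ']
  have h1 : (((k + 1 : ℕ) : ℤ) - ((0 : ℕ) : ℤ)).natAbs = k + 1 := by omega
  have h2 : (((k + 1 : ℕ) : ℤ) - ((2 * k + 1 + 1 : ℕ) : ℤ)).natAbs = k + 1 := by omega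
  have h3 : ∀ l : ℕ, (((k + 1 : ℕ) : ℤ) - ((l + 1 : ℕ) : ℤ)) = (k : ℤ) - l := fun l => by omega
  rw [h1, h2]
  simp only [h3]
  ring

/-- With `R` for `pochRatio c`, the recurrence turns `(k+c) R(k) + 2c R(k+1)` into `(k+1+c) R(k+1)`,
so the symmetric partial sums have a closed form. This is the identity that singles out these
moments. -/
theorem mul_pochSum {c : ℂ} {k : ℕ} (h : ∀ i : ℕ, 1 ≤ i → i ≤ k → c ≠ i) :
    c * pochSum c k = (k + c) * pochRatio c k := by
  induction k with
  | zero => simp [pochSum, pochRatio_zero]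
  | succ k ih =>
    have h1 := ih fun i hi hik => h i hi (by omega)
    have h2 := pochRatio_succ (h (k + 1) (by omega) le_rfl)
    rw [pochSum_succ]
    push_cast
    linear_combination h1 - h2

/-- The value of the moment functional on `∑ⱼ ζ^{je} (1 - sⱼ)/αⱼ` of `z^{b+2h+1} z̄^b`. -/
def momentSum (m : ℕ) (c : ℂ) (e : ℤ) (h : ℕ) : ℂ :=
  ∑ i ∈ Finset.range (2 * h + 1),
    (if (m : ℤ) ∣ e + i then (m : ℂ) else 0) * (-1) ^ i * moment m c (2 * h - 2 * i)

theorem momentSum_reflect {m : ℕ} (hm : m ≠ 0) (c : ℂ) (e : ℤ) (h : ℕ) :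
    momentSum m c (e - (2 * h + 1)) h = momentSum m c (1 - e) h := by
  rw [momentSum, momentSum, ← Finset.sum_range_reflect]
  refine Finset.sum_congr rfl fun i hi => ?_
  have hi := Finset.mem_range.1 hi
  have h1 : (m : ℤ) ∣ e - (2 * h + 1) + ((2 * h + 1 - 1 - i : ℕ) : ℤ) ↔ (m : ℤ) ∣ 1 - e + i := by
    rw [← dvd_neg]
    congr! 1
    omega
  have h2 : (-1 : ℂ) ^ (2 * h + 1 - 1 - i) = (-1) ^ i := by
    rw [neg_one_pow_eq_pow_mod_two, neg_one_pow_eq_pow_mod_two (n := i)]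
    congr 1
    omega
  rw [h2, if_congr h1 rfl rfl, ← moment_neg hm c (2 * h - 2 * i)]
  congr 2
  omega

/-- Only the indices `i = m l` survive. There `(-1)^i` and the sign of the moment multiply to a
constant independent of `l`. -/
theorem momentSum_zero_mul {m : ℕ} (hm : m ≠ 0) (c : ℂ) (k : ℕ) :
    momentSum m c 0 (m * k) = m * ((-1) ^ m) ^ (k : ℤ) * pochSum c k := by
  rw [momentSum, pochSum, Finset.mul_sum]
  symm
  have hm' : 0 < m := Nat.pos_of_ne_zero hm
  refine Finset.sum_of_injOn (fun l => m * l) (fun a _ b _ h => Nat.eq_of_mul_eq_mul_left hm' h)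
    ?_ ?_ ?_
  · intro l hl
    have hl := Finset.mem_range.1 (Finset.mem_coe.1 hl)
    have : m * l ≤ m * (2 * k) := Nat.mul_le_mul_left m (by omega)
    exact Finset.mem_coe.2 (Finset.mem_range.2 (by linarith))
  · intro i hi hi'
    rw [if_neg, zero_mul, zero_mul]
    rintro hd
    rw [zero_add, Int.natCast_dvd_natCast] at hd
    obtain ⟨l, rfl⟩ := hd
    refine hi' ⟨l, ?_, rfl⟩
    have h1 : m * l < m * (2 * k) + 1 := by
      have := Finset.mem_range.1 hi
      linarith
    have := Nat.le_of_mul_le_mul_left (Nat.le_of_lt_succ h1) hm'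
    exact Finset.mem_coe.2 (Finset.mem_range.2 (by omega))
  · intro l _
    have h1 : (2 * ((m * k : ℕ) : ℤ) - 2 * ((m * l : ℕ) : ℤ)) = 2 * m * ((k : ℤ) - l) := by
      push_cast; ring
    have hne : ((-1 : ℂ) ^ m) ≠ 0 := pow_ne_zero _ (by norm_num)
    rw [if_pos (by simp), h1, moment_mul hm, pow_mul, ← zpow_natCast (_ ^ m) l]
    rw [show ((-1 : ℂ) ^ m) ^ (k : ℤ) = ((-1) ^ m) ^ (l : ℤ) * ((-1) ^ m) ^ ((k : ℤ) - l) by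
      rw [← zpow_add₀ hne]; congr 1; ring]
    ring

/-- Here the surviving indices are `i = m(l+1) - 1`; the shift by one is the source of the minus
sign. -/
theorem momentSum_one_mul {m : ℕ} (hm : m ≠ 0) (c : ℂ) {k h : ℕ} (hh : h + 1 = m * (k + 1)) :
    momentSum m c 1 h = -(m * ((-1) ^ m) ^ ((k : ℤ) + 1) * pochSum c k) := by
  rw [momentSum, pochSum, Finset.mul_sum, ← Finset.sum_neg_distrib]
  symm
  have hm' : 0 < m := Nat.pos_of_ne_zero hm
  have hpos : ∀ l, 0 < m * (l + 1) := fun l => by positivity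
  refine Finset.sum_of_injOn (fun l => m * (l + 1) - 1) (fun a _ b _ h => ?_) ?_ ?_ ?_
  · have h : m * (a + 1) - 1 = m * (b + 1) - 1 := h
    have ha := hpos a
    have hb := hpos b
    have : m * (a + 1) = m * (b + 1) := by omega
    have := Nat.eq_of_mul_eq_mul_left hm' this
    omega
  · intro l hl
    have hl := Finset.mem_range.1 (Finset.mem_coe.1 hl)
    have h1 : m * (l + 1) ≤ m * (2 * k + 1) := Nat.mul_le_mul_left m (by omega)
    have h2 := hpos l
    have h3 : m * (2 * k + 1) + m = 2 * (h + 1) := by rw [hh]; ring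
    exact Finset.mem_coe.2 (Finset.mem_range.2 (show m * (l + 1) - 1 < 2 * h + 1 by omega))
  · intro i hi hi'
    rw [if_neg, zero_mul, zero_mul]
    rintro hd
    obtain ⟨l, hl⟩ : m ∣ i + 1 := by
      rw [← Int.natCast_dvd_natCast]; push_cast; rwa [add_comm]
    have h0 : l ≠ 0 := by rintro rfl; omega
    obtain ⟨l, rfl⟩ := Nat.exists_eq_succ_of_ne_zero h0
    refine hi' ⟨l, ?_, ?_⟩
    · have h1 : m * (l + 1) < m * (2 * (k + 1)) := by
        have := Finset.mem_range.1 hi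
        have h3 : m * (2 * (k + 1)) = 2 * (h + 1) := by rw [hh]; ring
        rw [h3, ← Nat.succ_eq_add_one, ← hl]
        omega
      have := Nat.lt_of_mul_lt_mul_left h1
      exact Finset.mem_coe.2 (Finset.mem_range.2 (by omega))
    · show m * (l + 1) - 1 = i
      rw [← Nat.succ_eq_add_one, ← hl]
      omega
  · intro l _
    have h2 := hpos l
    have h1 : (2 * (h : ℤ) - 2 * ((m * (l + 1) - 1 : ℕ) : ℤ)) = 2 * m * ((k : ℤ) - l) := by
      have : (h : ℤ) + 1 = m * (k + 1) := by exact_mod_cast hh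
      push_cast [Nat.one_le_of_lt h2]
      linear_combination 2 * this
    have hne : ((-1 : ℂ) ^ m) ≠ 0 := pow_ne_zero _ (by norm_num)
    have hd : (m : ℤ) ∣ 1 + ((m * (l + 1) - 1 : ℕ) : ℤ) := ⟨l + 1, by
      push_cast [Nat.one_le_of_lt h2]; ring⟩
    have hs : (-1 : ℂ) ^ (m * (l + 1) - 1) = -(((-1) ^ m) ^ ((l : ℤ) + 1)) := by
      have : (-1 : ℂ) ^ (m * (l + 1)) = (-1) ^ (m * (l + 1) - 1) * (-1) := by
        rw [← pow_succ]; congr 1; omega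
      rw [pow_mul] at this
      have h4 : ((-1 : ℂ) ^ m) ^ ((l : ℤ) + 1) = ((-1) ^ m) ^ (l + 1) := by
        exact_mod_cast rfl
      rw [h4, this]; ring
    rw [if_pos hd, h1, moment_mul hm, hs]
    rw [show ((-1 : ℂ) ^ m) ^ ((k : ℤ) + 1) =
      ((-1) ^ m) ^ ((l : ℤ) + 1) * ((-1) ^ m) ^ ((k : ℤ) - l) by
      rw [← zpow_add₀ hne]; congr 1; ring]
    ring

theorem momentSum_zero {m n : ℕ} (hm : m ≠ 0) {c : ℂ}
    (hc : ∀ k : ℕ, 1 ≤ k → m * k ≤ n → c ≠ k) {h : ℕ} (hn : h ≤ n) :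
    c * momentSum m c 0 h = (h + c * m) * moment m c (2 * h) := by
  by_cases hd : m ∣ h
  · obtain ⟨k, rfl⟩ := hd
    have h1 := mul_pochSum (c := c) (k := k) fun i hi hik =>
      hc i hi (le_trans (Nat.mul_le_mul_left m hik) hn)
    have h2 : (2 * ((m * k : ℕ) : ℤ)) = 2 * m * (k : ℤ) := by push_cast; ring
    rw [momentSum_zero_mul hm, h2, moment_mul hm, Int.natAbs_natCast]
    push_cast
    linear_combination (m * ((-1 : ℂ) ^ m) ^ (k : ℤ)) * h1
  · have h1 : ∀ x : ℤ, (m : ℤ) ∣ h - x → ¬ (m : ℤ) ∣ x := fun x h1 h2 => hd (by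
      have := dvd_add h1 h2
      rwa [sub_add_cancel, Int.natCast_dvd_natCast] at this)
    rw [moment_of_not_dvd, momentSum, Finset.sum_eq_zero, mul_zero, mul_zero]
    · intro i _
      by_cases hi : (m : ℤ) ∣ 0 + i
      · rw [moment_of_not_dvd, mul_zero]
        rw [← mul_sub, mul_dvd_mul_iff_left two_ne_zero]
        exact fun h2 => h1 _ h2 (by rwa [zero_add] at hi)
      · rw [if_neg hi, zero_mul, zero_mul]
    · rw [mul_dvd_mul_iff_left two_ne_zero]
      exact fun h2 => h1 0 (by simpa using h2) (dvd_zero _)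

/-- If `m` does not divide `h + 1`, no index meets both divisibility conditions and both sides
vanish. Otherwise the closed form of the partial sum is pushed from `k` to `k + 1` by the
recurrence, which is why the next moment appears and `h + 1 ≤ n` is required. -/
theorem momentSum_one {m n : ℕ} (hm : m ≠ 0) {c : ℂ}
    (hc : ∀ k : ℕ, 1 ≤ k → m * k ≤ n → c ≠ k) {h : ℕ} (hn : h + 1 ≤ n) :
    c * momentSum m c 1 h = -((h + 1 - c * m) * moment m c (2 * h + 2)) := by
  by_cases hd : m ∣ h + 1
  · obtain ⟨k, hk⟩ := hd
    have h0 : k ≠ 0 := by rintro rfl; omega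
    obtain ⟨k, rfl⟩ := Nat.exists_eq_succ_of_ne_zero h0
    rw [Nat.succ_eq_add_one] at hk
    have hne : ∀ i : ℕ, 1 ≤ i → i ≤ k + 1 → c ≠ i := fun i hi hik =>
      hc i hi (le_trans (Nat.mul_le_mul_left m hik) (hk ▸ hn))
    have h1 := mul_pochSum (c := c) (k := k) fun i hi hik => hne i hi (by omega)
    have h2 := pochRatio_succ (hne (k + 1) (by omega) le_rfl)
    have hz : (h : ℤ) + 1 = m * (k + 1) := by exact_mod_cast hk
    have hC : (h : ℂ) + 1 = m * (k + 1) := by exact_mod_cast hk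
    have h3 : (2 * (h : ℤ) + 2) = 2 * m * ((k : ℤ) + 1) := by linear_combination 2 * hz
    have h4 : ((k : ℤ) + 1).natAbs = k + 1 := by omega
    rw [momentSum_one_mul hm c hk, h3, moment_mul hm, h4, hC]
    linear_combination (-(m * ((-1 : ℂ) ^ m) ^ ((k : ℤ) + 1))) * (h1 - h2)
  · have h1 : ∀ x : ℤ, (m : ℤ) ∣ (h + 1) - x → ¬ (m : ℤ) ∣ x := fun x h1 h2 => hd (by
      have := dvd_add h1 h2
      rw [sub_add_cancel] at this
      exact_mod_cast this)
    rw [moment_of_not_dvd, momentSum, Finset.sum_eq_zero, mul_zero, mul_zero, neg_zero]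
    · intro i _
      by_cases hi : (m : ℤ) ∣ 1 + i
      · rw [moment_of_not_dvd, mul_zero]
        rw [← mul_sub, mul_dvd_mul_iff_left two_ne_zero]
        exact fun h2 => h1 (1 + i) (by rwa [show (h : ℤ) + 1 - (1 + i) = h - i by ring]) hi
      · rw [if_neg hi, zero_mul, zero_mul]
    · rw [show (2 * (h : ℤ) + 2) = 2 * (h + 1) by ring, mul_dvd_mul_iff_left two_ne_zero]
      exact fun h2 => h1 0 (by simpa using h2) (dvd_zero _)

/-! ### The functional `φ`, its invariance and its values on Dunkl derivatives -/

/-- The moment functional `z^a z̄^b ↦ t (a - b)`. -/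
def phi (m : ℕ) (c : ℂ) : Poly →ₗ[ℂ] ℂ :=
  (basisMonomials (Fin 2) ℂ).constr ℂ fun d => moment m c ((d 0 : ℤ) - d 1)

theorem phi_mono (m : ℕ) (c : ℂ) (a b : ℕ) : phi m c (mono a b) = moment m c ((a : ℤ) - b) := by
  have := (basisMonomials (Fin 2) ℂ).constr_basis ℂ
    (fun d => moment m c ((d 0 : ℤ) - d 1)) (expo a b)
  rw [coe_basisMonomials, expo_zero, expo_one] at this
  rw [mono_eq_monomial]
  exact this

theorem phi_one {m : ℕ} (hm : m ≠ 0) (c : ℂ) : phi m c 1 = 1 := by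
  have := phi_mono m c 0 0
  simpa [mono, moment_zero hm] using this

theorem phi_e2_mul (m : ℕ) (c : ℂ) (f : Poly) : phi m c (X 0 * X 1 * f) = phi m c f := by
  have : phi m c ∘ₗ LinearMap.mulLeft ℂ (X 0 * X 1) = phi m c := by
    refine linearMap_ext fun a b => ?_
    have h : (X 0 * X 1 : Poly) * mono a b = mono (a + 1) (b + 1) := by simp only [mono]; ring
    rw [LinearMap.comp_apply, LinearMap.mulLeft_apply, h, phi_mono, phi_mono]
    congr 1
    push_cast; ring
  exact DFunLike.congr_fun this f

theorem phi_e2_pow_mul (m : ℕ) (c : ℂ) (k : ℕ) (f : Poly) :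
    phi m c ((X 0 * X 1) ^ k * f) = phi m c f := by
  induction k with
  | zero => simp
  | succ k ih => rw [pow_succ', mul_assoc, phi_e2_mul, ih]

/-- Moments are even and supported on multiples of `2m`, where the sign and the root of unity
produced by a reflection are both 1. -/
theorem phi_reflection {m : ℕ} (hm : m ≠ 0) (c : ℂ) (j : ℕ) (f : Poly) :
    phi m c (reflection m j f) = phi m c f := by
  have hprim : IsPrimitiveRoot (zeta m) m := Complex.isPrimitiveRoot_exp m hm
  have : phi m c ∘ₗ (reflection m j).toLinearMap = phi m c := by
    refine linearMap_ext fun a b => ?_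
    rw [LinearMap.comp_apply, AlgHom.toLinearMap_apply, reflection_mono, map_smul, phi_mono,
      phi_mono, ← moment_neg hm, neg_sub, smul_eq_mul]
    by_cases h : (2 * m : ℤ) ∣ (a : ℤ) - b
    · have hz : (zeta m ^ j) ^ ((a : ℤ) - b) = 1 := by
        rw [← zpow_natCast, ← zpow_mul, hprim.zpow_eq_one_iff_dvd]
        exact Dvd.dvd.mul_left (dvd_trans (dvd_mul_left _ _) h) _
      have h2 : (2 : ℤ) ∣ (a : ℤ) - b := dvd_trans (dvd_mul_right _ _) h
      have hs : Even (a + b) := Nat.even_iff.2 (by omega)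
      rw [hz, hs.neg_one_pow, one_mul, one_mul]
    · rw [moment_of_not_dvd c h, mul_zero]
  exact DFunLike.congr_fun this f

theorem phi_diffSum_mono {m : ℕ} (hm : m ≠ 0) (c : ℂ) (e : ℤ) (b h : ℕ) :
    phi m c (diffSum m e (mono (b + (2 * h + 1)) b)) = momentSum m c e h := by
  rw [diffSum_mono hm, map_sum, momentSum]
  refine Finset.sum_congr rfl fun i hi => ?_
  have hi := Finset.mem_range.1 hi
  rw [map_smul, phi_mono, smul_eq_mul]
  congr 2
  omega

theorem phi_diffSum_mono_swap {m : ℕ} (hm : m ≠ 0) (c : ℂ) (e : ℤ) (a h : ℕ) :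
    phi m c (diffSum m e (mono a (a + (2 * h + 1)))) = momentSum m c (1 - e) h := by
  rw [diffSum_mono_swap, map_neg, map_smul, phi_diffSum_mono hm, Odd.neg_one_pow ⟨h, rfl⟩,
    ← momentSum_reflect hm]
  push_cast
  simp

/-- The degree is odd, so `a ≠ b` in every monomial. The difference part is evaluated by
`momentSum_zero` if `a > b` and by `momentSum_one` if `a < b`; combined with the derivative term
`a`, both give the factor `M + 1 - cm`. -/
theorem phi_dunklZ {m n : ℕ} (hm : m ≠ 0) {c : ℂ}
    (hc : ∀ k : ℕ, 1 ≤ k → m * k ≤ n → c ≠ k) {M : ℕ} (hM : M + 1 ≤ n) {u : Poly}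
    (hu : u.IsHomogeneous (2 * M + 1)) :
    phi m c (dunklZ m c u) = ((M : ℂ) + 1 - c * m) * phi m c (X 1 * u) := by
  refine map_eq_of_isHomogeneous (phi m c ∘ₗ dunklZ m c)
    (((M : ℂ) + 1 - c * m) • (phi m c ∘ₗ LinearMap.mulLeft ℂ (X 1))) (fun a b hab => ?_) hu
  have h1 : (X 1 : Poly) * mono a b = mono a (b + 1) := by simp only [mono]; ring
  simp only [LinearMap.comp_apply, LinearMap.smul_apply, LinearMap.mulLeft_apply, h1, dunklZ_mono,
    map_sub, map_smul, smul_eq_mul]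
  rcases le_total b a with hle | hle
  · obtain ⟨h, rfl⟩ : ∃ h, a = b + (2 * h + 1) := ⟨(a - b) / 2, by omega⟩
    obtain rfl : M = b + h := by omega
    rw [phi_diffSum_mono hm, momentSum_zero hm hc (by omega), phi_mono, phi_mono,
      show ((b + (2 * h + 1) - 1 : ℕ) : ℤ) - b = 2 * h by omega,
      show ((b + (2 * h + 1) : ℕ) : ℤ) - ((b + 1 : ℕ) : ℤ) = 2 * h by omega]
    push_cast
    ring
  · obtain ⟨h, rfl⟩ : ∃ h, b = a + (2 * h + 1) := ⟨(b - a) / 2, by omega⟩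
    obtain rfl : M = a + h := by omega
    rw [phi_diffSum_mono_swap hm, sub_zero, momentSum_one hm hc (by omega), phi_mono, phi_mono,
      show (a : ℤ) - ((a + (2 * h + 1) + 1 : ℕ) : ℤ) = -(2 * h + 2) by omega, moment_neg hm]
    -- For `a = 0` the truncated exponent `a - 1` is wrong, but the coefficient `a` kills that term.
    rcases Nat.eq_zero_or_pos a with rfl | ha
    · push_cast
      ring
    · rw [show ((a - 1 : ℕ) : ℤ) - ((a + (2 * h + 1) : ℕ) : ℤ) = -(2 * h + 2) by omega,
        moment_neg hm]
      push_cast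
      ring

/-- The moment of index `2(M+1)` occurs only for `b = 0`, so the stronger bound on `M` is asked only
then. This lets `phi_dunklZbar_X_mul` reach `M = n`, the boundary case used in Green's formula. -/
theorem phi_dunklZbar_mono {m n : ℕ} (hm : m ≠ 0) {c : ℂ}
    (hc : ∀ k : ℕ, 1 ≤ k → m * k ≤ n → c ≠ k) {M a b : ℕ} (hab : a + b = 2 * M + 1) (hM : M ≤ n)
    (hb : b = 0 → M + 1 ≤ n) :
    phi m c (dunklZbar m c (mono a b)) = ((M : ℂ) + 1 - c * m) * phi m c (X 0 * mono a b) := by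
  have h1 : (X 0 : Poly) * mono a b = mono (a + 1) b := by simp only [mono]; ring
  simp only [h1, dunklZbar_mono, map_sub, map_smul, smul_eq_mul]
  rcases le_total a b with hle | hle
  · obtain ⟨h, rfl⟩ : ∃ h, b = a + (2 * h + 1) := ⟨(b - a) / 2, by omega⟩
    obtain rfl : M = a + h := by omega
    rw [phi_diffSum_mono_swap hm, sub_self, momentSum_zero hm hc (by omega), phi_mono, phi_mono,
      show (a : ℤ) - ((a + (2 * h + 1) - 1 : ℕ) : ℤ) = -(2 * h) by omega,
      show ((a + 1 : ℕ) : ℤ) - ((a + (2 * h + 1) : ℕ) : ℤ) = -(2 * h) by omega, moment_neg hm]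
    push_cast
    ring
  · obtain ⟨h, rfl⟩ : ∃ h, a = b + (2 * h + 1) := ⟨(a - b) / 2, by omega⟩
    obtain rfl : M = b + h := by omega
    rw [phi_diffSum_mono hm, momentSum_one hm hc (by omega), phi_mono, phi_mono,
      show ((b + (2 * h + 1) + 1 : ℕ) : ℤ) - b = 2 * h + 2 by omega]
    rcases Nat.eq_zero_or_pos b with rfl | hb
    · push_cast
      ring
    · rw [show ((b + (2 * h + 1) : ℕ) : ℤ) - ((b - 1 : ℕ) : ℤ) = 2 * h + 2 by omega]
      push_cast
      ring

theorem phi_dunklZbar {m n : ℕ} (hm : m ≠ 0) {c : ℂ}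
    (hc : ∀ k : ℕ, 1 ≤ k → m * k ≤ n → c ≠ k) {M : ℕ} (hM : M + 1 ≤ n) {u : Poly}
    (hu : u.IsHomogeneous (2 * M + 1)) :
    phi m c (dunklZbar m c u) = ((M : ℂ) + 1 - c * m) * phi m c (X 0 * u) :=
  map_eq_of_isHomogeneous (phi m c ∘ₗ dunklZbar m c)
    (((M : ℂ) + 1 - c * m) • (phi m c ∘ₗ LinearMap.mulLeft ℂ (X 0)))
    (fun _ _ hab => phi_dunklZbar_mono hm hc hab (by omega) fun _ => hM) hu

theorem phi_dunklZbar_X_mul {m n : ℕ} (hm : m ≠ 0) {c : ℂ}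
    (hc : ∀ k : ℕ, 1 ≤ k → m * k ≤ n → c ≠ k) {M : ℕ} (hM : M ≤ n) {u : Poly}
    (hu : u.IsHomogeneous (2 * M)) :
    phi m c (dunklZbar m c (X 1 * u)) = ((M : ℂ) + 1 - c * m) * phi m c u := by
  rw [← phi_e2_mul m c u, mul_assoc]
  refine map_eq_of_isHomogeneous (phi m c ∘ₗ dunklZbar m c ∘ₗ LinearMap.mulLeft ℂ (X 1))
    (((M : ℂ) + 1 - c * m) •
      (phi m c ∘ₗ LinearMap.mulLeft ℂ (X 0) ∘ₗ LinearMap.mulLeft ℂ (X 1)))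
    (fun a b hab => ?_) hu
  have h1 : (X 1 : Poly) * mono a b = mono a (b + 1) := by simp only [mono]; ring
  simp only [LinearMap.comp_apply, LinearMap.smul_apply, LinearMap.mulLeft_apply, h1, smul_eq_mul]
  exact phi_dunklZbar_mono hm hc (by omega) hM (by omega)

/-! ### Green's formula -/

theorem phi_eq_zero_of_reflection_eq_neg {m : ℕ} (hm : m ≠ 0) (c : ℂ) {j : ℕ} {f : Poly}
    (h : reflection m j f = -f) : phi m c f = 0 := by
  have := phi_reflection hm c j f
  rw [h, map_neg] at this
  linear_combination (-1 / 2 : ℂ) * this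

/-- The defect in the Leibniz rule for `(1 - sⱼ)/αⱼ` is `αⱼ` times a product of two invariant
difference quotients. It is anti-invariant under `sⱼ`, hence killed by `φ`. -/
theorem phi_diffSum_mul {m : ℕ} (hm : m ≠ 0) (c : ℂ) (e : ℤ) (f g : Poly) :
    phi m c (diffSum m e (f * g)) = phi m c (diffSum m e f * g) + phi m c (f * diffSum m e g) := by
  rw [← map_add]
  simp only [diffSum_apply, Finset.sum_mul, Finset.mul_sum, ← Finset.sum_add_distrib, map_sum]
  refine Finset.sum_congr rfl fun j _ => ?_
  have h0 : phi m c (root m j * (diffQuot m j f * diffQuot m j g)) = 0 := by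
    refine phi_eq_zero_of_reflection_eq_neg hm c (j := j) ?_
    rw [map_mul, map_mul, reflection_root, reflection_diffQuot, reflection_diffQuot]
    ring
  have h1 : diffQuot m j (f * g) = diffQuot m j f * g + f * diffQuot m j g
      - root m j * (diffQuot m j f * diffQuot m j g) := by
    rw [diffQuot_mul]
    linear_combination (diffQuot m j g) * root_mul_diffQuot m j f
  rw [h1, smul_mul_assoc, mul_smul_comm, ← smul_add, map_smul, map_smul, map_sub, h0, sub_zero]

theorem phi_dunklZ_mul {m : ℕ} (hm : m ≠ 0) (c : ℂ) (f g : Poly) :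
    phi m c (dunklZ m c (f * g)) = phi m c (dunklZ m c f * g) + phi m c (f * dunklZ m c g) := by
  have h := phi_diffSum_mul hm c 0 f g
  simp only [dunklZ_apply, ← smul_eq_C_mul, sub_mul, mul_sub, smul_mul_assoc, mul_smul_comm,
    map_sub, map_smul, Derivation.leibniz, map_add, smul_eq_mul, h]
  rw [mul_comm g]
  ring

theorem phi_dunklZbar_mul {m : ℕ} (hm : m ≠ 0) (c : ℂ) (f g : Poly) :
    phi m c (dunklZbar m c (f * g)) =
      phi m c (dunklZbar m c f * g) + phi m c (f * dunklZbar m c g) := by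
  have h := phi_diffSum_mul hm c 1 f g
  simp only [dunklZbar_apply, ← smul_eq_C_mul, sub_mul, mul_sub, smul_mul_assoc, mul_smul_comm,
    map_sub, map_smul, Derivation.leibniz, map_add, smul_eq_mul, h]
  rw [mul_comm g]
  ring

/-! ### Nondegeneracy and orthogonality -/

/-- For regular `c` the moment functional induces a nondegenerate form on polynomials of
degree `k`. -/
theorem eq_zero_of_phi_mul_eq_zero {m n : ℕ} (hm : m ≠ 0) {c : ℂ}
    (hc : ∀ k : ℕ, 1 ≤ k → m * k ≤ n → c ≠ k) (hreg : IsRegular m c) {k : ℕ} (hk : k ≤ n)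
    {f : Poly} (hf : f.IsHomogeneous k)
    (h : ∀ v : Poly, v.IsHomogeneous k → phi m c (f * v) = 0) : f = 0 := by
  induction k generalizing f with
  | zero =>
    have h1 := totalDegree_eq_zero_iff_eq_C.1 ((totalDegree_zero_iff_isHomogeneous _).2 hf)
    have h2 := h 1 (isHomogeneous_one _ _)
    rw [mul_one, h1, ← mul_one (C _), ← smul_eq_C_mul, map_smul, phi_one hm, smul_eq_mul,
      mul_one] at h2
    rw [h1, h2, C_0]
  | succ k ih =>
    -- Multiplication by `e₂` does not change `φ`, so `f` is also orthogonal to forms of degree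
    -- lower by two, such as derivatives of test forms of degree `k`.
    have he2 : ∀ w : Poly, (∀ k', k = k' + 1 → w.IsHomogeneous k') → (k = 0 → w = 0) →
        phi m c (f * w) = 0 := fun w hw hw0 => by
      rcases Nat.eq_zero_or_pos k with h0 | hpos
      · rw [hw0 h0, mul_zero, map_zero]
      · obtain ⟨k', rfl⟩ := Nat.exists_eq_succ_of_ne_zero hpos.ne'
        rw [← phi_e2_mul, mul_left_comm]
        refine h _ ?_
        have := ((isHomogeneous_X ℂ (0 : Fin 2)).mul (isHomogeneous_X ℂ 1)).mul (hw k' rfl)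
        rwa [show 1 + 1 + k' = k'.succ + 1 by omega] at this
    -- Integration by parts moves `∇_z` from `f` to `v`. The boundary term pairs `f` with `z̄ v` and
    -- the other term pairs it with `∇_z v`; both vanish, so the induction hypothesis applies to
    -- `∇_z f`.
    have hZ : dunklZ m c f = 0 := by
      refine ih (by omega) (dunklZ_isHomogeneous hm c hf) fun v hv => ?_
      have h1 := phi_dunklZ hm hc (M := k) hk (u := f * v) (by
        have := hf.mul hv
        rwa [show k + 1 + k = 2 * k + 1 by ring] at this)
      rw [phi_dunklZ_mul hm, mul_left_comm, h (X 1 * v) (by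
        have := (isHomogeneous_X ℂ (1 : Fin 2)).mul hv
        rwa [add_comm 1 k] at this), mul_zero, he2 (dunklZ m c v), add_zero] at h1
      · exact h1
      · rintro k' rfl
        exact dunklZ_isHomogeneous hm c hv
      · rintro rfl
        exact dunklZ_eq_zero hm c hv
    have hZbar : dunklZbar m c f = 0 := by
      refine ih (by omega) (dunklZbar_isHomogeneous hm c hf) fun v hv => ?_
      have h1 := phi_dunklZbar hm hc (M := k) hk (u := f * v) (by
        have := hf.mul hv
        rwa [show k + 1 + k = 2 * k + 1 by ring] at this)
      rw [phi_dunklZbar_mul hm, mul_left_comm, h (X 0 * v) (by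
        have := (isHomogeneous_X ℂ (0 : Fin 2)).mul hv
        rwa [add_comm 1 k] at this), mul_zero, he2 (dunklZbar m c v), add_zero] at h1
      · exact h1
      · rintro k' rfl
        exact dunklZbar_isHomogeneous hm c hv
      · rintro rfl
        exact dunklZbar_eq_zero hm c hv
    by_contra hne
    refine hreg ⟨f, ?_, fun y => ?_⟩
    · rw [hf.totalDegree hne]; omega
    · rw [dunkl_eq]
      simp [hZ, hZbar]

/-- Green's formula. Integrating by parts twice moves `∇_z∇_{z̄}` from `f` to `v`; with `λ = n - i -
cm`, the boundary terms leave `λ (φ(z f ∇_z v) - φ(z̄ v ∇_{z̄} f))`. Integrating `∇_{z̄}(z̄ f v)`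
and using Euler's formula shows that the bracket is `-(i+1) φ(f v)`. -/
theorem phi_mul_dunklZbar_dunklZ {m n : ℕ} (hm : m ≠ 0) {c : ℂ}
    (hc : ∀ k : ℕ, 1 ≤ k → m * k ≤ n → c ≠ k) {f : Poly} (hf : f.IsHomogeneous (n + 1))
    (hf0 : dunklE2 m c f = 0) {e i : ℕ} (he : e + 2 * i + 1 = n) {v : Poly}
    (hv : v.IsHomogeneous e) :
    phi m c (f * dunklZbar m c (dunklZ m c v)) =
      -(((i : ℂ) + 1) * ((n : ℂ) - i - c * m)) * phi m c (f * v) := by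
  obtain ⟨M, rfl⟩ : ∃ M, n = M + 1 + i := ⟨e + i, by omega⟩
  obtain rfl : M = e + i := by omega
  rw [dunklE2_eq, LinearMap.comp_apply] at hf0
  have hf' := dunklZbar_isHomogeneous hm c hf
  have h1 := phi_dunklZ hm hc (M := e + i) (by omega) (u := dunklZbar m c f * v) (by
    have := hf'.mul hv
    rwa [show e + i + 1 + i + e = 2 * (e + i) + 1 by ring] at this)
  rw [phi_dunklZ_mul hm, hf0, zero_mul, map_zero, zero_add] at h1
  have h2 := phi_dunklZbar hm hc (M := e + i) (by omega) (u := f * dunklZ m c v) (by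
    rcases e with _ | e
    · rw [dunklZ_eq_zero hm c hv, mul_zero]
      exact isHomogeneous_zero _ _ _
    · have := hf.mul (dunklZ_isHomogeneous hm c hv)
      rwa [show e + 1 + i + 1 + i + 1 + e = 2 * (e + 1 + i) + 1 by ring] at this)
  rw [phi_dunklZbar_mul hm] at h2
  have h3 := phi_dunklZbar_X_mul hm hc (M := e + i + 1) (by omega) (u := f * v) (by
    have := hf.mul hv
    rwa [show e + i + 1 + i + 1 + e = 2 * (e + i + 1) by ring] at this)
  rw [mul_left_comm, phi_dunklZbar_mul hm, dunklZbar_X_mul] at h3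
  have h4 := X_mul_dunkl m c hv
  have h5 : f * (X 1 * dunklZbar m c v + v - c • reflectionSum m v) =
      ((e : ℂ) - c * m) • (f * v) + f * v - X 0 * (f * dunklZ m c v) := by
    rw [← mul_smul_comm]
    linear_combination f * h4
  rw [h5, map_sub, map_add, map_smul, smul_eq_mul] at h3
  rw [mul_left_comm (X 1)] at h1
  push_cast at h1 h2 h3 ⊢
  linear_combination h2 - h1 - ((e : ℂ) + i + 1 - c * m) * h3

/-- Quasiharmonic polynomials of degree `n + 1` are orthogonal to polynomials of lower degree. -/
theorem phi_mul_eq_zero {m n : ℕ} (hm : m ≠ 0) {c : ℂ}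
    (hc : ∀ k : ℕ, 1 ≤ k → m * k ≤ n → c ≠ k)
    (hcm : ∀ i : ℕ, 2 * i + 1 ≤ n → c * m ≠ (n : ℂ) - i) {f : Poly}
    (hf : f ∈ quasiharmonics m c (n + 1)) {e i : ℕ} (he : e + 2 * i + 1 = n) {v : Poly}
    (hv : v.IsHomogeneous e) : phi m c (f * v) = 0 := by
  induction e using Nat.strong_induction_on generalizing i v with
  | _ e ih =>
    -- The left side of Green's formula pairs `f` with a form of degree `e - 2`, so it vanishes by
    -- induction, while the scalar on the right is nonzero by `hcm`.
    have h := phi_mul_dunklZbar_dunklZ hm hc hf.1 hf.2 he hv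
    have h0 : phi m c (f * dunklZbar m c (dunklZ m c v)) = 0 := by
      rcases e with _ | _ | e
      · rw [dunklZ_eq_zero hm c hv, map_zero, mul_zero, map_zero]
      · rw [dunklZbar_eq_zero hm c (dunklZ_isHomogeneous hm c hv), mul_zero, map_zero]
      · exact ih e (by omega) (i := i + 1) (by omega)
          (dunklZbar_isHomogeneous hm c (dunklZ_isHomogeneous hm c hv))
    rw [h0] at h
    have h1 : ((i : ℂ) + 1) ≠ 0 := by exact_mod_cast Nat.succ_ne_zero i
    have h2 : (n : ℂ) - i - c * m ≠ 0 := fun h' => hcm i (by omega) (by linear_combination -h')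
    exact (mul_eq_zero.1 h.symm).resolve_left (neg_ne_zero.2 (mul_ne_zero h1 h2))

/-! ### Singular parameters -/

/-- If `cm` is a positive integer not divisible by `m`, then `c` is singular. -/
theorem not_isRegular {m : ℕ} (hm : m ≠ 0) {c : ℂ} {k : ℕ} (hk : ¬ m ∣ k + 1)
    (hc : c * m = (k + 1 : ℕ)) : ¬ IsRegular m c := by
  -- The extra exponent is `k + 1` itself. Since `∇_{z̄}` preserves the residue class, it has a
  -- nonzero kernel element `f` there.
  have hcard : (residueClass m (k + 1) ((k + 1 : ℕ) : ℤ)).card =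
      (residueClass m k ((k + 1 : ℕ) : ℤ)).card + 1 := by
    rw [residueClass, Finset.range_add_one, Finset.filter_insert, if_pos (by simp),
      Finset.card_insert_of_notMem (by simp)]
    rfl
  have hdim := le_finrank_inf_ker (dunklZbar m c)
    (fun f hf => dunklZbar_mem hm c (k := k) (x := ((k + 1 : ℕ) : ℤ)) hf) (k := 1)
    (by rw [finrank_binaryForms, finrank_binaryForms, hcard])
  obtain ⟨⟨f, hf⟩, hne⟩ := Module.finrank_pos_iff_exists_ne_zero.1 hdim
  have hne : f ≠ 0 := fun h => hne (Subtype.ext h)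
  have hfhom := binaryForms_le_homogeneousSubmodule (residueClass_subset _ _ _) hf.1
  have hZbar : dunklZbar m c f = 0 := hf.2
  -- In this class `a - b` is congruent to `k + 1` modulo `m`, hence nonzero, so the sum over the
  -- roots of unity vanishes. Euler's formula with `cm = k + 1` then reads `z ∇_z f = 0`.
  have hsum : reflectionSum m f = 0 := by
    rw [← Submodule.mem_bot ℂ]
    refine map_mem_of_binaryForms (residueClass_subset _ _ _) _ (fun a b ha hab => ?_) hf.1
    have ha := (mem_residueClass.1 ha).2
    rw [Submodule.mem_bot, reflectionSum_apply]
    simp only [reflection_mono]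
    rw [← Finset.sum_smul, ← Finset.mul_sum, sum_zeta_zpow hm, if_neg, mul_zero, zero_smul]
    intro hd
    refine hk ?_
    rw [← Int.natCast_dvd_natCast]
    have h1 := dvd_sub hd (dvd_mul_of_dvd_right ha 2)
    rwa [show (a : ℤ) - b - 2 * (a - ((k + 1 : ℕ) : ℤ)) = ((k + 1 : ℕ) : ℤ) by omega] at h1
  have hZ : dunklZ m c f = 0 := by
    have h := X_mul_dunkl m c hfhom
    rw [hZbar, hsum, hc, sub_self, zero_smul, smul_zero, mul_zero, add_zero, add_zero] at h
    exact (mul_eq_zero.1 h).resolve_left (X_ne_zero 0)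
  intro hreg
  refine hreg ⟨f, ?_, fun y => ?_⟩
  · rw [IsHomogeneous.totalDegree hfhom hne]; omega
  · rw [dunkl_eq]
    simp [hZ, hZbar]

theorem IsRegular.mul_ne {m n : ℕ} (hm : m ≠ 0) {c : ℂ}
    (hc : ∀ k : ℕ, 1 ≤ k → m * k ≤ n → c ≠ k) (hreg : IsRegular m c) {i : ℕ}
    (hi : 2 * i + 1 ≤ n) : c * m ≠ (n : ℂ) - i := by
  intro h
  obtain ⟨k, hk⟩ : ∃ k, n = k + 1 + i := ⟨n - i - 1, by omega⟩
  have h1 : c * m = (k + 1 : ℕ) := by rw [h, hk]; push_cast; ring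
  by_cases hd : m ∣ k + 1
  · obtain ⟨l, hl⟩ := hd
    refine hc l (Nat.one_le_iff_ne_zero.2 (by rintro rfl; omega)) (by omega) ?_
    rw [hl, Nat.cast_mul, mul_comm (m : ℂ)] at h1
    exact mul_right_cancel₀ (Nat.cast_ne_zero.2 hm) h1
  · exact not_isRegular hm hd h1 hreg

/-! ### Homogeneous components -/

theorem homogeneousComponent_mul_of_le {k N : ℕ} (hk : k ≤ N) {f : Poly}
    (hf : f.IsHomogeneous k) (g : Poly) :
    homogeneousComponent N (f * g) = f * homogeneousComponent (N - k) g := by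
  have : homogeneousComponent N ∘ₗ LinearMap.mulLeft ℂ f =
      LinearMap.mulLeft ℂ f ∘ₗ homogeneousComponent (N - k) := by
    refine linearMap_ext fun a b => ?_
    have h := mono_isHomogeneous a b
    simp only [LinearMap.comp_apply, LinearMap.mulLeft_apply]
    rw [homogeneousComponent_of_mem (hf.mul h), homogeneousComponent_of_mem h]
    by_cases hab : a + b = N - k
    · rw [if_pos hab.symm, if_pos (by omega)]
    · rw [if_neg (Ne.symm hab), if_neg (by omega), mul_zero]
  exact DFunLike.congr_fun this g

theorem homogeneousComponent_mul_of_lt {k N : ℕ} (hk : N < k) {f : Poly}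
    (hf : f.IsHomogeneous k) (g : Poly) : homogeneousComponent N (f * g) = 0 := by
  have : homogeneousComponent N ∘ₗ LinearMap.mulLeft ℂ f = 0 := by
    refine linearMap_ext fun a b => ?_
    have h := mono_isHomogeneous a b
    simp only [LinearMap.comp_apply, LinearMap.mulLeft_apply]
    rw [homogeneousComponent_of_mem (hf.mul h), if_neg (by omega), LinearMap.zero_apply]
  exact DFunLike.congr_fun this g

theorem exists_eq_X_mul_add_X_mul {k : ℕ} {u : Poly} (hu : u.IsHomogeneous (k + 1)) :
    ∃ a b : Poly, a.IsHomogeneous k ∧ b.IsHomogeneous k ∧ u = X 0 * a + X 1 * b := by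
  have := map_mem_of_isHomogeneous
    (W := (homogeneousSubmodule (Fin 2) ℂ k).map (LinearMap.mulLeft ℂ (X 0)) ⊔
      (homogeneousSubmodule (Fin 2) ℂ k).map (LinearMap.mulLeft ℂ (X 1))) LinearMap.id
    (fun a b hab => by
      rcases Nat.eq_zero_or_pos a with rfl | ha
      · refine Submodule.mem_sup_right ⟨mono 0 (b - 1), ?_, ?_⟩
        · have := mono_isHomogeneous 0 (b - 1)
          rwa [show 0 + (b - 1) = k by omega] at this
        · obtain ⟨b, rfl⟩ : ∃ b', b = b' + 1 := ⟨b - 1, by omega⟩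
          simp [mono, pow_succ']
      · refine Submodule.mem_sup_left ⟨mono (a - 1) b, ?_, ?_⟩
        · have := mono_isHomogeneous (a - 1) b
          rwa [show a - 1 + b = k by omega] at this
        · obtain ⟨a, rfl⟩ : ∃ a', a = a' + 1 := ⟨a - 1, by omega⟩
          simp [mono, pow_succ', mul_assoc]) hu
  obtain ⟨_, ⟨a, ha, rfl⟩, _, ⟨b, hb, rfl⟩, h⟩ := Submodule.mem_sup.1 this
  exact ⟨a, b, ha, hb, h.symm⟩

/-! ### Dimension counts -/

/-- The pairing of homogeneous polynomials of degrees `k` and `l` induced by a functional. -/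
def mulForm (ψ : Poly →ₗ[ℂ] ℂ) (k l : ℕ) :
    homogeneousSubmodule (Fin 2) ℂ k →ₗ[ℂ] Module.Dual ℂ (homogeneousSubmodule (Fin 2) ℂ l) :=
  ((LinearMap.mul ℂ Poly).compr₂ ψ).domRestrict₁₂ _ _

theorem mulForm_apply (ψ : Poly →ₗ[ℂ] ℂ) (k l : ℕ) (v : homogeneousSubmodule (Fin 2) ℂ k)
    (w : homogeneousSubmodule (Fin 2) ℂ l) : mulForm ψ k l v w = ψ (v * w) := rfl

theorem mulForm_injective {ψ : Poly →ₗ[ℂ] ℂ} {k l : ℕ}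
    (h : ∀ v : Poly, v.IsHomogeneous k →
      (∀ w : Poly, w.IsHomogeneous l → ψ (v * w) = 0) → v = 0) :
    Function.Injective (mulForm ψ k l) := by
  rw [injective_iff_map_eq_zero]
  intro v hv
  refine Subtype.ext (h v v.2 fun w hw => ?_)
  rw [← mulForm_apply ψ k l v ⟨w, hw⟩, hv, LinearMap.zero_apply]

theorem exists_phi_mul_eq {ψ : Poly →ₗ[ℂ] ℂ} {k : ℕ}
    (h : ∀ v : Poly, v.IsHomogeneous k →
      (∀ w : Poly, w.IsHomogeneous k → ψ (v * w) = 0) → v = 0) (l : Poly →ₗ[ℂ] ℂ) :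
    ∃ w : Poly, w.IsHomogeneous k ∧ ∀ v : Poly, v.IsHomogeneous k → ψ (w * v) = l v := by
  have hd : Module.finrank ℂ (homogeneousSubmodule (Fin 2) ℂ k) =
      Module.finrank ℂ (Module.Dual ℂ (homogeneousSubmodule (Fin 2) ℂ k)) :=
    Subspace.dual_finrank_eq.symm
  have hs := (LinearMap.injective_iff_surjective_of_finrank_eq_finrank hd).1 (mulForm_injective h)
  obtain ⟨w, hw⟩ := hs (l.domRestrict _)
  refine ⟨w, w.2, fun v hv => ?_⟩
  rw [← mulForm_apply ψ k k w ⟨v, hv⟩, hw, LinearMap.domRestrict_apply]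

/-- A space of forms of degree `n + 1` orthogonal to the forms of degree `n - 1` under a pairing
that is nondegenerate on the latter has dimension at most two. -/
theorem finrank_le_two {ψ : Poly →ₗ[ℂ] ℂ} {n : ℕ} {V : Submodule ℂ Poly}
    (hV : V ≤ homogeneousSubmodule (Fin 2) ℂ (n + 1))
    (h0 : ∀ k, k + 1 = n → ∀ f ∈ V, ∀ v : Poly, v.IsHomogeneous k → ψ (v * f) = 0)
    (h1 : ∀ k, k + 1 = n → ∀ v : Poly, v.IsHomogeneous k →
      (∀ w : Poly, w.IsHomogeneous (n + 1) → ψ (v * w) = 0) → v = 0) :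
    Module.finrank ℂ V ≤ 2 := by
  rcases n with _ | k
  · exact (Submodule.finrank_mono hV).trans_eq (finrank_homogeneousSubmodule 1)
  have hinj := mulForm_injective (h1 k rfl)
  set V' := V.comap (homogeneousSubmodule (Fin 2) ℂ (k + 1 + 1)).subtype
  have hV' : Module.finrank ℂ V' = Module.finrank ℂ V :=
    (Submodule.comapSubtypeEquivOfLe hV).finrank_eq
  have hr : LinearMap.range (mulForm ψ k (k + 1 + 1)) ≤ V'.dualAnnihilator := by
    rintro _ ⟨v, rfl⟩
    rw [Submodule.mem_dualAnnihilator]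
    intro w hw
    exact h0 k rfl w hw v v.2
  have h2 := Submodule.finrank_mono hr
  rw [LinearMap.finrank_range_of_inj hinj, finrank_homogeneousSubmodule] at h2
  have h3 := Subspace.finrank_add_finrank_dualAnnihilator_eq V'
  rw [finrank_homogeneousSubmodule] at h3
  omega

theorem dunklE2_isHomogeneous {m : ℕ} (hm : m ≠ 0) (c : ℂ) {k : ℕ} {f : Poly}
    (hf : f.IsHomogeneous (k + 2)) : (dunklE2 m c f).IsHomogeneous k := by
  rw [dunklE2_eq]
  exact dunklZ_isHomogeneous hm c (dunklZbar_isHomogeneous hm c hf)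

/-- Forms of degree `d + 1` have dimension `d + 2`, and `∇_z∇_{z̄}` maps them to a space of
dimension `d`. -/
theorem two_le_finrank_quasiharmonics {m : ℕ} (hm : m ≠ 0) (c : ℂ) (d : ℕ) :
    2 ≤ Module.finrank ℂ (quasiharmonics m c (d + 1)) := by
  rcases d with _ | k
  · refine le_finrank_inf_ker (W := ⊥) _ (fun f hf => ?_) ?_
    · rw [Submodule.mem_bot, dunklE2_eq]
      exact dunklZ_eq_zero hm c (dunklZbar_isHomogeneous hm c hf)
    · rw [finrank_bot, finrank_homogeneousSubmodule]
  · refine le_finrank_inf_ker (W := homogeneousSubmodule (Fin 2) ℂ k) _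
      (fun f hf => dunklE2_isHomogeneous hm c hf) ?_
    rw [finrank_homogeneousSubmodule, finrank_homogeneousSubmodule]

/-! ### The annihilator of the moment functional -/

/-- The ideal of polynomials `u` with `φ(uv) = 0` for all `v` of complementary degree. -/
def momentIdeal (m : ℕ) (c : ℂ) (N : ℕ) : Ideal Poly where
  carrier := {u | ∀ v, phi m c (homogeneousComponent N (u * v)) = 0}
  add_mem' ha hb v := by rw [add_mul, map_add, map_add, ha v, hb v, add_zero]
  zero_mem' v := by rw [zero_mul, map_zero, map_zero]
  smul_mem' a u hu v := by rw [smul_eq_mul, mul_right_comm, mul_comm, mul_comm a]; exact hu _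

theorem mem_momentIdeal_of_lt {m : ℕ} {c : ℂ} {N k : ℕ} (hk : N < k) {u : Poly}
    (hu : u.IsHomogeneous k) : u ∈ momentIdeal m c N := fun v => by
  rw [homogeneousComponent_mul_of_lt hk hu, map_zero]

theorem mem_momentIdeal_iff {m : ℕ} {c : ℂ} {N k l : ℕ} (hk : k + l = N) {u : Poly}
    (hu : u.IsHomogeneous k) :
    u ∈ momentIdeal m c N ↔ ∀ v : Poly, v.IsHomogeneous l → phi m c (u * v) = 0 := by
  subst hk
  refine ⟨fun h v hv => ?_, fun h v => ?_⟩
  · have := h v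
    rwa [homogeneousComponent_eq_self (hu.mul hv)] at this
  · rw [homogeneousComponent_mul_of_le (by omega) hu]
    exact h _ (by simpa using homogeneousComponent_isHomogeneous _ v)

theorem homogeneousComponent_mem_momentIdeal {m : ℕ} {c : ℂ} {N : ℕ} {u : Poly}
    (hu : u ∈ momentIdeal m c N) (k : ℕ) : homogeneousComponent k u ∈ momentIdeal m c N := by
  rcases lt_or_ge N k with h | h
  · exact mem_momentIdeal_of_lt h (homogeneousComponent_isHomogeneous k u)
  · rw [mem_momentIdeal_iff (l := N - k) (by omega) (homogeneousComponent_isHomogeneous k u)]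
    intro v hv
    have h1 := hu v
    rw [mul_comm, homogeneousComponent_mul_of_le (by omega) hv, Nat.sub_sub_self h] at h1
    rwa [mul_comm]

theorem quasiharmonicIdeal_le_momentIdeal {m n : ℕ} (hm : m ≠ 0) {c : ℂ}
    (hc : ∀ k : ℕ, 1 ≤ k → m * k ≤ n → c ≠ k)
    (hcm : ∀ i : ℕ, 2 * i + 1 ≤ n → c * m ≠ (n : ℂ) - i) :
    quasiharmonicIdeal m c (n + 1) ≤ momentIdeal m c (2 * n) := by
  refine Ideal.span_le.2 fun f hf => ?_
  rcases n with _ | k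
  · exact mem_momentIdeal_of_lt (by omega) hf.1
  · refine (mem_momentIdeal_iff (l := k) (by omega) hf.1).2 fun v hv => ?_
    exact phi_mul_eq_zero hm hc hcm hf (i := 0) (by omega) hv

/-! ### The quasiharmonic ideal for regular `c` -/

section Regular

variable {m n : ℕ} (hm : m ≠ 0) {c : ℂ} (hc : ∀ k : ℕ, 1 ≤ k → m * k ≤ n → c ≠ k)
  (hreg : IsRegular m c)

include hm hc hreg

theorem eq_zero_of_mem_momentIdeal {k : ℕ} (hk : k ≤ n) {u : Poly} (hu : u.IsHomogeneous k)
    (h : u ∈ momentIdeal m c (2 * n)) : u = 0 := by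
  refine eq_zero_of_phi_mul_eq_zero hm hc hreg hk hu fun v hv => ?_
  rw [mem_momentIdeal_iff (l := 2 * n - k) (by omega) hu] at h
  rw [← phi_e2_pow_mul m c (n - k), mul_left_comm]
  refine h _ ?_
  have := (((isHomogeneous_X ℂ (0 : Fin 2)).mul (isHomogeneous_X ℂ 1)).pow (n - k)).mul hv
  rwa [show (1 + 1) * (n - k) + k = 2 * n - k by omega] at this

/-- A dimension squeeze: the quasiharmonics, of dimension at least two, lie in the annihilator, of
dimension at most two. -/
theorem inf_momentIdeal_le_quasiharmonics :
    homogeneousSubmodule (Fin 2) ℂ (n + 1) ⊓ (momentIdeal m c (2 * n)).restrictScalars ℂ ≤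
      quasiharmonics m c (n + 1) := by
  have hle : quasiharmonics m c (n + 1) ≤
      homogeneousSubmodule (Fin 2) ℂ (n + 1) ⊓ (momentIdeal m c (2 * n)).restrictScalars ℂ :=
    fun f hf => ⟨hf.1, quasiharmonicIdeal_le_momentIdeal hm hc
      (fun i hi => hreg.mul_ne hm hc hi) (Ideal.subset_span hf)⟩
  refine (Submodule.eq_of_le_of_finrank_le hle ?_).ge
  refine le_trans (finrank_le_two (ψ := phi m c) inf_le_left ?_ ?_)
    (two_le_finrank_quasiharmonics hm c n)
  · intro k hk f hf v hv
    rw [mul_comm]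
    exact (mem_momentIdeal_iff (l := k) (by omega) hf.1).1 hf.2 v hv
  · intro k hk v hv h
    refine eq_zero_of_mem_momentIdeal hm hc hreg (by omega) hv ?_
    exact (mem_momentIdeal_iff (l := n + 1) (by omega) hv).2 h

/-- A decomposition `u = z a + z̄ b` may be changed to `(a + z̄ w', b - z w')`. Both entries lie in
the ideal once `φ(w' z̄ v) = -φ(a v)` and `φ(w' z v) = φ(b v)` for all `v` of degree `e = 2n - k`.
This prescribes `φ(w' ·)` on forms of degree `e + 1`, and nondegeneracy in that degree, at most `n`,
supplies a solution. -/
theorem exists_mem_momentIdeal_eq {k : ℕ} (hnk : n + 1 ≤ k) (hk : k ≤ 2 * n) {u : Poly}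
    (hu : u.IsHomogeneous (k + 1)) (h : u ∈ momentIdeal m c (2 * n)) :
    ∃ a b : Poly, a.IsHomogeneous k ∧ b.IsHomogeneous k ∧ a ∈ momentIdeal m c (2 * n) ∧
      b ∈ momentIdeal m c (2 * n) ∧ u = X 0 * a + X 1 * b := by
  obtain ⟨a, b, ha, hb, rfl⟩ := exists_eq_X_mul_add_X_mul hu
  obtain ⟨e, he⟩ : ∃ e, k + e = 2 * n := ⟨2 * n - k, by omega⟩
  -- The prescribed functional: the condition on `b` fixes it on multiples of `z`, and the condition
  -- on `a` on the remaining power of `z̄`.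
  let l : Poly →ₗ[ℂ] ℂ := (basisMonomials (Fin 2) ℂ).constr ℂ fun d =>
    if d 0 = 0 then -phi m c (a * mono 0 (d 1 - 1)) else phi m c (b * mono (d 0 - 1) (d 1))
  have hl : ∀ i j, l (mono i j) =
      if i = 0 then -phi m c (a * mono 0 (j - 1)) else phi m c (b * mono (i - 1) j) := by
    intro i j
    have := (basisMonomials (Fin 2) ℂ).constr_basis ℂ (fun d => if d 0 = 0 then
      -phi m c (a * mono 0 (d 1 - 1)) else phi m c (b * mono (d 0 - 1) (d 1))) (expo i j)
    rw [coe_basisMonomials, expo_zero, expo_one] at this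
    rw [mono_eq_monomial]
    exact this
  obtain ⟨w, hw, hwl⟩ := exists_phi_mul_eq (ψ := phi m c) (k := e + 1)
    (fun v hv => eq_zero_of_phi_mul_eq_zero hm hc hreg (by omega) hv) l
  -- The power of `e₂`, invisible to `φ`, raises the degree of `w` from `e + 1` to `k - 1`.
  set w' := (X 0 * X 1) ^ (n - (e + 1)) * w
  have hw' : w'.IsHomogeneous (k - 1) := by
    have := (((isHomogeneous_X ℂ (0 : Fin 2)).mul
      (isHomogeneous_X ℂ 1)).pow (n - (e + 1))).mul hw
    rwa [show (1 + 1) * (n - (e + 1)) + (e + 1) = k - 1 by omega] at this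
  have hXw : ∀ i : Fin 2, (X i * w').IsHomogeneous k := fun i => by
    have := (isHomogeneous_X ℂ i).mul hw'
    rwa [show 1 + (k - 1) = k by omega] at this
  have hwv : ∀ (i : Fin 2) (v : Poly), v.IsHomogeneous e →
      phi m c (X i * w' * v) = l (X i * v) := fun i v hv => by
    rw [mul_right_comm, mul_comm, mul_assoc, phi_e2_pow_mul]
    refine hwl _ ?_
    have := (isHomogeneous_X ℂ i).mul hv
    rwa [add_comm] at this
  refine ⟨a + X 1 * w', b - X 0 * w', ha.add (hXw 1), hb.sub (hXw 0), ?_, ?_, by ring⟩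
  · refine (mem_momentIdeal_iff he (ha.add (hXw 1))).2 fun v hv => ?_
    rw [add_mul, map_add, hwv 1 v hv, ← eq_neg_iff_add_eq_zero]
    refine map_eq_of_isHomogeneous (phi m c ∘ₗ LinearMap.mulLeft ℂ a)
      (-(l ∘ₗ LinearMap.mulLeft ℂ (X 1))) (fun i j hij => ?_) hv
    have h1 : (X 1 : Poly) * mono i j = mono i (j + 1) := by simp only [mono]; ring
    simp only [LinearMap.comp_apply, LinearMap.neg_apply, LinearMap.mulLeft_apply, h1, hl]
    rcases i with _ | i
    · simp
    · rw [if_neg (Nat.succ_ne_zero i), Nat.add_sub_cancel, eq_neg_iff_add_eq_zero, ← map_add]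
      -- The two prescriptions overlap on multiples of `z z̄`, where they agree precisely because
      -- `u` is in the ideal.
      have h2 := (mem_momentIdeal_iff (l := i + j) (by omega) hu).1 h _ (mono_isHomogeneous i j)
      convert h2 using 2
      simp only [mono]
      ring
  · refine (mem_momentIdeal_iff he (hb.sub (hXw 0))).2 fun v hv => ?_
    rw [sub_mul, map_sub, hwv 0 v hv, sub_eq_zero]
    refine map_eq_of_isHomogeneous (phi m c ∘ₗ LinearMap.mulLeft ℂ b)
      (l ∘ₗ LinearMap.mulLeft ℂ (X 0)) (fun i j hij => ?_) hv
    have h1 : (X 0 : Poly) * mono i j = mono (i + 1) j := by simp only [mono]; ring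
    simp only [LinearMap.comp_apply, LinearMap.mulLeft_apply, h1, hl]
    rw [if_neg (Nat.succ_ne_zero i), Nat.add_sub_cancel]

theorem mem_quasiharmonicIdeal_of_isHomogeneous {k : ℕ} (hk : n + 1 ≤ k) {u : Poly}
    (hu : u.IsHomogeneous k) (h : u ∈ momentIdeal m c (2 * n)) :
    u ∈ quasiharmonicIdeal m c (n + 1) := by
  induction k, hk using Nat.le_induction generalizing u with
  | base => exact Ideal.subset_span (inf_momentIdeal_le_quasiharmonics hm hc hreg ⟨hu, h⟩)
  | succ k hk ih =>
    obtain ⟨a, b, ha, hb, ha', hb', rfl⟩ : ∃ a b : Poly, a.IsHomogeneous k ∧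
        b.IsHomogeneous k ∧ a ∈ momentIdeal m c (2 * n) ∧ b ∈ momentIdeal m c (2 * n) ∧
        u = X 0 * a + X 1 * b := by
      rcases le_or_gt k (2 * n) with h' | h'
      · exact exists_mem_momentIdeal_eq hm hc hreg hk h' hu h
      · obtain ⟨a, b, ha, hb, rfl⟩ := exists_eq_X_mul_add_X_mul hu
        exact ⟨a, b, ha, hb, mem_momentIdeal_of_lt h' ha, mem_momentIdeal_of_lt h' hb, rfl⟩
    exact Ideal.add_mem _ (Ideal.mul_mem_left _ _ (ih ha ha')) (Ideal.mul_mem_left _ _ (ih hb hb'))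

/-- For regular `c` the quasiharmonic ideal is the annihilator of the moment functional. -/
theorem quasiharmonicIdeal_eq_momentIdeal :
    quasiharmonicIdeal m c (n + 1) = momentIdeal m c (2 * n) := by
  refine le_antisymm (quasiharmonicIdeal_le_momentIdeal hm hc fun i hi => hreg.mul_ne hm hc hi)
    fun u hu => ?_
  rw [← sum_homogeneousComponent u]
  refine Ideal.sum_mem _ fun k _ => ?_
  have h := homogeneousComponent_mem_momentIdeal hu k
  have hhom := homogeneousComponent_isHomogeneous k u
  rcases le_or_gt k n with h' | h'
  · rw [eq_zero_of_mem_momentIdeal hm hc hreg h' hhom h]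
    exact Ideal.zero_mem _
  · exact mem_quasiharmonicIdeal_of_isHomogeneous hm hc hreg h' hhom h

end Regular

/-! ### The grading of the quotient algebra -/

section Grading

variable {J : Ideal Poly}

theorem mk_mem_quotientComponent {k : ℕ} {u : Poly} (hu : u.IsHomogeneous k) :
    Ideal.Quotient.mk J u ∈ quotientComponent J k := ⟨u, hu, rfl⟩

theorem quotientComponent_gradedMonoid (J : Ideal Poly) :
    SetLike.GradedMonoid (quotientComponent J) where
  one_mem := ⟨1, isHomogeneous_one _ _, map_one (Ideal.Quotient.mkₐ ℂ J)⟩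
  mul_mem := by
    rintro i j _ _ ⟨u, hu, rfl⟩ ⟨v, hv, rfl⟩
    exact ⟨u * v, IsHomogeneous.mul hu hv, map_mul (Ideal.Quotient.mkₐ ℂ J) u v⟩

theorem quotientComponent_isInternal
    (hJ : ∀ u ∈ J, ∀ k, homogeneousComponent k u ∈ J) :
    DirectSum.IsInternal (quotientComponent J) := by
  classical
  refine ⟨(injective_iff_map_eq_zero _).2 fun x hx => ?_, fun a => ?_⟩
  · rw [DirectSum.coeAddMonoidHom_eq_dfinsuppSum] at hx
    choose u hu hux using fun i => (x i).2
    have hmem : ∑ i ∈ DFinsupp.support x, u i ∈ J := by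
      rw [← Ideal.Quotient.eq_zero_iff_mem, map_sum, ← hx]
      exact Finset.sum_congr rfl fun i _ => hux i
    refine DFinsupp.ext fun k => ?_
    by_contra hk
    have hk' : k ∈ DFinsupp.support x := DFinsupp.mem_support_iff.2 hk
    have h := hJ _ hmem k
    rw [map_sum, Finset.sum_eq_single_of_mem k hk' fun i _ hi => by
      rw [homogeneousComponent_of_mem (hu i), if_neg hi.symm],
      homogeneousComponent_eq_self (hu k), ← Ideal.Quotient.eq_zero_iff_mem] at h
    exact hk (Subtype.ext ((hux k).symm.trans h))
  · obtain ⟨u, rfl⟩ := Ideal.Quotient.mk_surjective a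
    refine ⟨∑ k ∈ Finset.range (u.totalDegree + 1),
      DirectSum.of (fun k => quotientComponent J k) k
        ⟨_, mk_mem_quotientComponent (homogeneousComponent_isHomogeneous k u)⟩, ?_⟩
    rw [map_sum]
    simp only [DirectSum.coeAddMonoidHom_of]
    rw [← map_sum, sum_homogeneousComponent]

/-- Valid for an arbitrary grading structure, so it applies to the one hidden in the existential of
`IsStandardFrobenius`. -/
theorem proj_mk [GradedAlgebra (quotientComponent J)] (N : ℕ) (u : Poly) :
    GradedAlgebra.proj (quotientComponent J) N (Ideal.Quotient.mk J u) =
      Ideal.Quotient.mk J (homogeneousComponent N u) := by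
  have : GradedAlgebra.proj (quotientComponent J) N ∘ₗ (Ideal.Quotient.mkₐ ℂ J).toLinearMap =
      (Ideal.Quotient.mkₐ ℂ J).toLinearMap ∘ₗ homogeneousComponent N := by
    refine linearMap_ext fun a b => ?_
    have h := mono_isHomogeneous a b
    simp only [LinearMap.comp_apply, GradedAlgebra.proj_apply, homogeneousComponent_of_mem h]
    have hmem : (Ideal.Quotient.mkₐ ℂ J).toLinearMap (mono a b) ∈ quotientComponent J (a + b) :=
      mk_mem_quotientComponent h
    split_ifs with hN
    · subst hN
      rw [DirectSum.decompose_of_mem_same _ hmem]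
    · rw [DirectSum.decompose_of_mem_ne _ hmem (Ne.symm hN), map_zero]
  exact DFunLike.congr_fun this u

instance (k : ℕ) : FiniteDimensional ℂ (quotientComponent J k) := by
  rw [quotientComponent]; infer_instance

theorem finiteDimensional_quotient {N : ℕ} (hN : ∀ k, N < k → quotientComponent J k = ⊥) :
    FiniteDimensional ℂ (Poly ⧸ J) := by
  have htop : (Finset.range (N + 1)).sup (quotientComponent J) = ⊤ := by
    refine eq_top_iff.2 fun a _ => ?_
    obtain ⟨u, rfl⟩ := Ideal.Quotient.mk_surjective a
    rw [← sum_homogeneousComponent u, map_sum]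
    refine Submodule.sum_mem _ fun k _ => ?_
    have hmem := mk_mem_quotientComponent (J := J) (homogeneousComponent_isHomogeneous k u)
    rcases le_or_gt k N with h | h
    · exact Finset.le_sup (f := quotientComponent J) (Finset.mem_range.2 (by omega)) hmem
    · rw [hN k h, Submodule.mem_bot] at hmem
      rw [hmem]
      exact Submodule.zero_mem _
  have h := Submodule.finiteDimensional_finset_sup (Finset.range (N + 1)) (quotientComponent J)
  rw [htop] at h
  exact Module.finite_def.2 (Module.Finite.iff_fg.1 h)

theorem adjoin_quotientComponent_one :
    Algebra.adjoin ℂ (quotientComponent J 1 : Set (Poly ⧸ J)) = ⊤ := by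
  refine eq_top_iff.2 ?_
  have h1 : (Algebra.adjoin ℂ (Set.range (X : Fin 2 → Poly))).map (Ideal.Quotient.mkₐ ℂ J) = ⊤ := by
    rw [adjoin_range_X, Algebra.map_top]
    exact (AlgHom.range_eq_top _).2 (Ideal.Quotient.mkₐ_surjective ℂ J)
  rw [← h1, AlgHom.map_adjoin]
  refine Algebra.adjoin_mono ?_
  rintro _ ⟨_, ⟨i, rfl⟩, rfl⟩
  exact mk_mem_quotientComponent (isHomogeneous_X ℂ i)

end Grading

/-! ### The Frobenius property for regular parameters -/

theorem e2_pow_isHomogeneous (n : ℕ) : ((X 0 * X 1 : Poly) ^ n).IsHomogeneous (2 * n) :=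
  ((isHomogeneous_X ℂ (0 : Fin 2)).mul (isHomogeneous_X ℂ 1)).pow n

theorem phi_e2_pow {m : ℕ} (hm : m ≠ 0) (c : ℂ) (n : ℕ) : phi m c ((X 0 * X 1) ^ n) = 1 := by
  rw [← mul_one (_ ^ n), phi_e2_pow_mul, phi_one hm]

theorem mem_momentIdeal_iff_phi {m : ℕ} {c : ℂ} {N : ℕ} {u : Poly} (hu : u.IsHomogeneous N) :
    u ∈ momentIdeal m c N ↔ phi m c u = 0 := by
  rw [mem_momentIdeal_iff (l := 0) (by omega) hu]
  refine ⟨fun h => ?_, fun h v hv => ?_⟩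
  · simpa using h 1 (isHomogeneous_one _ _)
  · rw [totalDegree_eq_zero_iff_eq_C.1 ((totalDegree_zero_iff_isHomogeneous _).2 hv), mul_comm,
      ← smul_eq_C_mul, map_smul, h, smul_zero]

/-- Once `J` is the annihilator of `φ`, nondegeneracy holds by construction, and `φ(e₂^n) = 1` makes
`e₂^n` span the top component. -/
theorem isStandardFrobenius {m n : ℕ} (hm : m ≠ 0) {c : ℂ}
    (hc : ∀ k : ℕ, 1 ≤ k → m * k ≤ n → c ≠ k) (hreg : IsRegular m c) :
    IsStandardFrobenius (quotientComponent (quasiharmonicIdeal m c (n + 1))) (2 * n) := by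
  have hJ := quasiharmonicIdeal_eq_momentIdeal hm hc hreg
  set J := quasiharmonicIdeal m c (n + 1)
  have hhom : ∀ u ∈ J, ∀ k, homogeneousComponent k u ∈ J := fun u hu k => by
    rw [hJ] at hu ⊢
    exact homogeneousComponent_mem_momentIdeal hu k
  have hbot : ∀ k, 2 * n < k → quotientComponent J k = ⊥ := fun k hk => by
    refine eq_bot_iff.2 ?_
    rintro _ ⟨u, hu, rfl⟩
    have : u ∈ J := hJ ▸ mem_momentIdeal_of_lt hk hu
    exact (Submodule.mem_bot ℂ).2 (Ideal.Quotient.eq_zero_iff_mem.2 this)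
  let : SetLike.GradedMonoid (quotientComponent J) := quotientComponent_gradedMonoid J
  let : DirectSum.Decomposition (quotientComponent J) :=
    (quotientComponent_isInternal hhom).chooseDecomposition
  let inst : GradedAlgebra (quotientComponent J) := {}
  refine ⟨inst, finiteDimensional_quotient hbot, hbot, ?_, adjoin_quotientComponent_one, ?_, ?_⟩
  · have hspan : quotientComponent J 0 = Submodule.span ℂ {Ideal.Quotient.mk J 1} := by
      refine le_antisymm ?_ ?_
      · rintro _ ⟨u, hu, rfl⟩
        have hC := totalDegree_eq_zero_iff_eq_C.1 ((totalDegree_zero_iff_isHomogeneous _).2 hu)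
        rw [hC, ← mul_one (C _), ← smul_eq_C_mul, map_smul]
        exact Submodule.smul_mem _ _ (Submodule.mem_span_singleton_self _)
      · rw [Submodule.span_singleton_le_iff_mem]
        exact mk_mem_quotientComponent (isHomogeneous_one _ _)
    rw [hspan, finrank_span_singleton]
    rw [Ne, Ideal.Quotient.eq_zero_iff_mem, hJ]
    exact fun h => one_ne_zero
      (eq_zero_of_mem_momentIdeal hm hc hreg (Nat.zero_le n) (isHomogeneous_one _ _) h)
  · have hspan : quotientComponent J (2 * n) =
        Submodule.span ℂ {Ideal.Quotient.mk J ((X 0 * X 1) ^ n)} := by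
      refine le_antisymm ?_ ?_
      · rintro _ ⟨u, hu, rfl⟩
        refine Submodule.mem_span_singleton.2 ⟨phi m c u, ?_⟩
        have hd : (phi m c u • (X 0 * X 1) ^ n - u).IsHomogeneous (2 * n) :=
          Submodule.sub_mem _ (Submodule.smul_mem _ _ (e2_pow_isHomogeneous n)) hu
        have h : phi m c u • (X 0 * X 1) ^ n - u ∈ J := by
          rw [hJ, mem_momentIdeal_iff_phi hd, map_sub, map_smul, phi_e2_pow hm, smul_eq_mul,
            mul_one, sub_self]
        exact (map_smul (Ideal.Quotient.mkₐ ℂ J) _ _).symm.trans (Ideal.Quotient.eq.2 h)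
      · rw [Submodule.span_singleton_le_iff_mem]
        exact mk_mem_quotientComponent (e2_pow_isHomogeneous n)
    rw [hspan, finrank_span_singleton]
    rw [Ne, Ideal.Quotient.eq_zero_iff_mem, hJ, mem_momentIdeal_iff_phi (e2_pow_isHomogeneous n),
      phi_e2_pow hm]
    exact one_ne_zero
  · intro a ha
    obtain ⟨u, rfl⟩ := Ideal.Quotient.mk_surjective a
    rw [Ideal.Quotient.eq_zero_iff_mem, hJ]
    intro v
    have h := ha (Ideal.Quotient.mk J v)
    rw [← map_mul, proj_mk, Ideal.Quotient.eq_zero_iff_mem, hJ,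
      mem_momentIdeal_iff_phi (homogeneousComponent_isHomogeneous _ _)] at h
    exact h

/-! ### Exclusion of the exceptional parameters -/

/-- The ideal of polynomials without terms of degree at most `n`. -/
def highDegreeIdeal (n : ℕ) : Ideal Poly where
  carrier := {u | ∀ k ≤ n, homogeneousComponent k u = 0}
  add_mem' ha hb k hk := by rw [map_add, ha k hk, hb k hk, add_zero]
  zero_mem' k _ := map_zero _
  smul_mem' a u hu k hk := by
    have : homogeneousComponent k ∘ₗ LinearMap.mulRight ℂ u = 0 := by
      refine linearMap_ext fun i j => ?_
      rw [LinearMap.comp_apply, LinearMap.mulRight_apply, LinearMap.zero_apply]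
      rcases le_or_gt (i + j) k with h | h
      · rw [homogeneousComponent_mul_of_le h (mono_isHomogeneous i j), hu _ (by omega), mul_zero]
      · exact homogeneousComponent_mul_of_lt h (mono_isHomogeneous i j) u
    exact DFunLike.congr_fun this a

theorem eq_zero_of_mem_quasiharmonicIdeal {m : ℕ} {c : ℂ} {n k : ℕ} (hk : k ≤ n) {u : Poly}
    (hu : u.IsHomogeneous k) (h : u ∈ quasiharmonicIdeal m c (n + 1)) : u = 0 := by
  have hle : quasiharmonicIdeal m c (n + 1) ≤ highDegreeIdeal n := by
    refine Ideal.span_le.2 fun f hf l hl => ?_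
    rw [homogeneousComponent_of_mem hf.1, if_neg (by omega)]
  rw [← homogeneousComponent_eq_self hu]
  exact hle h k hk

theorem coeff_eq_zero_of_mem_binaryForms {k : ℕ} {s : Finset ℕ} {f : Poly}
    (hf : f ∈ binaryForms k s) {a b : ℕ} (ha : a ∉ s) : coeff (expo a b) f = 0 := by
  have : binaryForms k s ≤ LinearMap.ker (lcoeff ℂ (expo a b)) := by
    refine Submodule.span_le.2 ?_
    rintro _ ⟨a', ha', rfl⟩
    rw [SetLike.mem_coe, LinearMap.mem_ker, lcoeff_apply]
    dsimp only
    rw [mono_eq_monomial, coeff_monomial, if_neg]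
    rintro h
    exact ha ((expo_injective h).1 ▸ ha')
  exact this hf

/-- In degree `n - 1` the ideal is zero, so the Frobenius form makes all `n` dimensions of that
degree act independently on degree `n + 1`, which has dimension `n + 2`, while annihilating the
quasiharmonics. -/
theorem finrank_quasiharmonics_le_two {m n : ℕ} {c : ℂ}
    (hF : IsStandardFrobenius (quotientComponent (quasiharmonicIdeal m c (n + 1))) (2 * n)) :
    Module.finrank ℂ (quasiharmonics m c (n + 1)) ≤ 2 := by
  set J := quasiharmonicIdeal m c (n + 1) with hJ
  obtain ⟨inst, -, -, -, -, hN, hnd⟩ := hF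
  obtain ⟨e⟩ : Nonempty (quotientComponent J (2 * n) ≃ₗ[ℂ] ℂ) :=
    FiniteDimensional.nonempty_linearEquiv_of_finrank_eq (by rw [hN, Module.finrank_self])
  obtain ⟨l, hl⟩ := LinearMap.exists_extend e.toLinearMap
  have hl0 : ∀ x ∈ quotientComponent J (2 * n), l x = 0 → x = 0 := fun x hx h => by
    have h1 : e ⟨x, hx⟩ = 0 := (DFunLike.congr_fun hl ⟨x, hx⟩).symm.trans h
    exact congrArg Subtype.val (e.map_eq_zero_iff.1 h1)
  refine finrank_le_two (ψ := l ∘ₗ (Ideal.Quotient.mkₐ ℂ J).toLinearMap) inf_le_left ?_ ?_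
  · intro k _ f hf v _
    have h1 : Ideal.Quotient.mk J (v * f) = 0 :=
      Ideal.Quotient.eq_zero_iff_mem.2 (Ideal.mul_mem_left _ _ (Ideal.subset_span hf))
    exact (congrArg l h1).trans (map_zero l)
  · intro k hk v hv h
    refine eq_zero_of_mem_quasiharmonicIdeal (m := m) (c := c) (n := n) (by omega) hv ?_
    rw [← hJ, ← Ideal.Quotient.eq_zero_iff_mem]
    refine hnd _ fun b => ?_
    obtain ⟨g, rfl⟩ := Ideal.Quotient.mk_surjective b
    have hg := homogeneousComponent_isHomogeneous (n + 1) g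
    rw [← map_mul, proj_mk, homogeneousComponent_mul_of_le (by omega) hv,
      show 2 * n - k = n + 1 by omega]
    refine hl0 _ (mk_mem_quotientComponent ?_) (h _ hg)
    have := hv.mul hg
    rwa [show k + (n + 1) = 2 * n by omega] at this

theorem e2_pow_mul_mem_quasiharmonics {m n i d : ℕ} {c : ℂ} (hd : d + 2 * i + 1 = n)
    (hcm : c * m = (n : ℂ) - i) {g : Poly} (hg : g ∈ quasiharmonics m c d) :
    (X 0 * X 1) ^ (i + 1) * g ∈ quasiharmonics m c (n + 1) := by
  refine ⟨?_, ?_⟩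
  · have := (e2_pow_isHomogeneous (i + 1)).mul hg.1
    rwa [show 2 * (i + 1) + d = n + 1 by omega] at this
  · have h0 : (d : ℂ) + (i + 1) - c * m = 0 := by
      rw [hcm, ← hd]
      push_cast
      ring
    have h1 : dunklE2 m c g = 0 := hg.2
    rw [SetLike.mem_coe, LinearMap.mem_ker, dunklE2_e2_pow_mul m c hg.1, h1, h0, mul_zero, mul_zero, zero_smul,
      add_zero]

/-- At this `c`, `e₂^{i+1}` carries quasiharmonics of degree `d + 1` to quasiharmonics of degree `n
+ 1`, and by dimension these are all of them. Then every generator of `J` is divisible by `z̄`, so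
no power of `z` lies in `J`. -/
theorem not_isStandardFrobenius_of_pos {m n i d : ℕ} {c : ℂ} (hm : m ≠ 0)
    (hd : d + 1 + 2 * i + 1 = n) (hcm : c * m = (n : ℂ) - i) :
    ¬ IsStandardFrobenius (quotientComponent (quasiharmonicIdeal m c (n + 1))) (2 * n) := by
  intro hF
  have h2 := finrank_quasiharmonics_le_two hF
  have hle : (quasiharmonics m c (d + 1)).map (LinearMap.mulLeft ℂ ((X 0 * X 1) ^ (i + 1))) ≤
      quasiharmonics m c (n + 1) := by
    rintro _ ⟨g, hg, rfl⟩
    exact e2_pow_mul_mem_quasiharmonics hd hcm hg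
  have hinj : Function.Injective (LinearMap.mulLeft ℂ ((X 0 * X 1 : Poly) ^ (i + 1))) :=
    fun f g h => mul_left_cancel₀
      (pow_ne_zero _ (mul_ne_zero (X_ne_zero 0) (X_ne_zero 1))) h
  have : FiniteDimensional ℂ (quasiharmonics m c (n + 1)) :=
    Submodule.finiteDimensional_of_le inf_le_left
  have heq := Submodule.eq_of_le_of_finrank_le hle (by
    rw [← (Submodule.equivMapOfInjective _ hinj _).finrank_eq]
    exact h2.trans (two_le_finrank_quasiharmonics hm c d))
  have hJ : quasiharmonicIdeal m c (n + 1) ≤ Ideal.span {X 1} := by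
    refine Ideal.span_le.2 fun f hf => ?_
    rw [← heq] at hf
    obtain ⟨g, -, rfl⟩ := hf
    refine Ideal.mem_span_singleton.2 ⟨X 0 * (X 0 * X 1) ^ i * g, ?_⟩
    rw [LinearMap.mulLeft_apply]
    ring
  obtain ⟨-, -, hbot, -⟩ := hF
  have hX : (X 0 ^ (2 * n + 1) : Poly) ∈ quasiharmonicIdeal m c (n + 1) := by
    have := mk_mem_quotientComponent (J := quasiharmonicIdeal m c (n + 1))
      (isHomogeneous_X_pow (R := ℂ) (0 : Fin 2) (2 * n + 1))
    rwa [hbot _ (by omega), Submodule.mem_bot, Ideal.Quotient.eq_zero_iff_mem] at this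
  obtain ⟨g, hg⟩ := Ideal.mem_span_singleton.1 (hJ hX)
  simpa using congrArg (eval ![(1 : ℂ), 0]) hg

/-- Here the cofactor has degree 0, so only the single quasiharmonic `e₂^{i+1}` arises and the
divisibility argument fails. But the exponent classes of `0` and `n + 1` modulo `m` already contain
two dimensions of quasiharmonics, and `e₂^{i+1}` lies outside them since `m` does not divide `i +
1`; three dimensions are too many. -/
theorem not_isStandardFrobenius_of_eq {m n i : ℕ} {c : ℂ} (hm : m ≠ 0)
    (hi : 2 * i + 1 = n) (hcm : c * m = (n : ℂ) - i) (hdvd : ¬ m ∣ n - i) :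
    ¬ IsStandardFrobenius (quotientComponent (quasiharmonicIdeal m c (n + 1))) (2 * n) := by
  intro hF
  have h2 := finrank_quasiharmonics_le_two hF
  have hdvd' : ¬ (m : ℤ) ∣ i + 1 := by
    rw [show n - i = i + 1 by omega] at hdvd
    exact_mod_cast hdvd
  have hmem : (X 0 * X 1) ^ (i + 1) * 1 ∈ quasiharmonics m c (n + 1) := by
    refine e2_pow_mul_mem_quasiharmonics (d := 0) (by omega) hcm ⟨isHomogeneous_one _ _, ?_⟩
    rw [SetLike.mem_coe, LinearMap.mem_ker, dunklE2_eq, LinearMap.comp_apply,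
      dunklZbar_eq_zero hm c (isHomogeneous_one _ _), map_zero]
  obtain ⟨l, rfl⟩ : ∃ l, n = l + 1 := ⟨n - 1, by omega⟩
  set P := residueClass m (l + 2) 0 ∪ residueClass m (l + 2) ((l + 2 : ℕ) : ℤ) with hP
  set Q := residueClass m l (-1) ∪ residueClass m l ((l + 1 : ℕ) : ℤ) with hQ
  have hPsub : P ⊆ Finset.range (l + 2 + 1) :=
    Finset.union_subset (residueClass_subset _ _ _) (residueClass_subset _ _ _)
  have hle : binaryForms (l + 2) P ⊓ LinearMap.ker (dunklE2 m c) ≤ quasiharmonics m c (l + 2) :=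
    inf_le_inf_right _ (binaryForms_le_homogeneousSubmodule hPsub)
  have hcard : Q.card + 2 ≤ P.card := by
    -- `∇_z∇_{z̄}` lowers the exponent class by one; the source classes gain the two extreme
    -- exponents `0` and `l + 2`, which are not shifts of target exponents.
    have hsub : insert 0 (insert (l + 2) (Q.image Nat.succ)) ⊆ P := by
      intro a ha
      simp only [Finset.mem_insert, Finset.mem_image, hQ, Finset.mem_union,
        mem_residueClass] at ha
      simp only [hP, Finset.mem_union, mem_residueClass]
      rcases ha with rfl | rfl | ⟨a, ha | ha, rfl⟩
      · exact Or.inl ⟨by omega, by simp⟩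
      · exact Or.inr ⟨by omega, by simp⟩
      · refine Or.inl ⟨by omega, ?_⟩
        convert ha.2 using 1
        push_cast
        ring
      · refine Or.inr ⟨by omega, ?_⟩
        convert ha.2 using 1
        push_cast
        ring
    have h := Finset.card_le_card hsub
    rwa [Finset.card_insert_of_notMem (by simp), Finset.card_insert_of_notMem,
      Finset.card_image_of_injective _ Nat.succ_injective] at h
    simp only [Finset.mem_image, hQ, Finset.mem_union, mem_residueClass, not_exists, not_and]
    rintro a ha h'
    rcases ha with ha | ha <;> omega
  have hdim := le_finrank_inf_ker (V := binaryForms (l + 2) P) (W := binaryForms l Q)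
    (dunklE2 m c) (fun f hf => map_mem_of_binaryForms hPsub _ (fun a b ha hab => ?_) hf) (k := 2)
    (by rwa [finrank_binaryForms, finrank_binaryForms])
  · have : FiniteDimensional ℂ (quasiharmonics m c (l + 2)) :=
      Submodule.finiteDimensional_of_le inf_le_left
    have heq := Submodule.eq_of_le_of_finrank_le hle (h2.trans hdim)
    rw [← heq] at hmem
    have h := coeff_eq_zero_of_mem_binaryForms hmem.1 (a := i + 1) (b := i + 1) (by
      simp only [hP, Finset.mem_union, mem_residueClass, not_or, not_and]
      refine ⟨fun _ h => hdvd' (by simpa using h), fun _ h => hdvd' ?_⟩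
      rwa [show ((i + 1 : ℕ) : ℤ) - ((l + 2 : ℕ) : ℤ) = -(i + 1) by omega, dvd_neg] at h)
    rw [mul_one, mul_pow, ← mono, mono_eq_monomial, coeff_monomial, if_pos rfl] at h
    exact one_ne_zero h
  · rw [dunklE2_eq]
    rcases Finset.mem_union.1 ha with ha | ha
    · have h1 := dunklZ_mem hm c (dunklZbar_mem hm c (mono_mem_binaryForms ha hab))
      exact Submodule.span_mono (Set.image_mono (Finset.coe_subset.2
        (by simp only [zero_sub]; exact Finset.subset_union_left))) h1
    · have h1 := dunklZ_mem hm c (dunklZbar_mem hm c (mono_mem_binaryForms ha hab))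
      refine Submodule.span_mono (Set.image_mono (Finset.coe_subset.2 ?_)) h1
      rw [show ((l + 2 : ℕ) : ℤ) - 1 = ((l + 1 : ℕ) : ℤ) by push_cast; ring]
      exact Finset.subset_union_right

theorem mul_ne_of_isStandardFrobenius {m n : ℕ} {c : ℂ} (hm : m ≠ 0)
    (hc : ∀ k : ℕ, 1 ≤ k → m * k ≤ n → c ≠ k)
    (hF : IsStandardFrobenius (quotientComponent (quasiharmonicIdeal m c (n + 1))) (2 * n))
    {i : ℕ} (hi : 2 * i + 1 ≤ n) : c * m ≠ (n : ℂ) - i := by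
  intro h
  have hdvd : ¬ m ∣ n - i := by
    rintro ⟨l, hl⟩
    refine hc l (Nat.one_le_iff_ne_zero.2 (by rintro rfl; omega)) (by omega) ?_
    rw [← Nat.cast_sub (by omega), hl, Nat.cast_mul, mul_comm (m : ℂ)] at h
    exact mul_right_cancel₀ (Nat.cast_ne_zero.2 hm) h
  rcases hi.eq_or_lt with hi | hi
  · exact not_isStandardFrobenius_of_eq hm hi h hdvd hF
  · exact not_isStandardFrobenius_of_pos hm (d := n - 2 * i - 2) (by omega) h hF

/-! ### The characteristic polynomial -/

/-- The sum over the support of `p` becomes the value of a linear map at `p`, giving linearity in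
the first argument. -/
theorem pairing_eq (p u : Poly) : pairing p u =
    (basisMonomials (Fin 2) ℂ).constr ℂ
      (fun d => (∏ i, ((d i).factorial : ℂ)) * coeff d u) p := by
  conv_rhs => rw [← p.support_sum_monomial_coeff, map_sum]
  refine Finset.sum_congr rfl fun d _ => ?_
  have h := (basisMonomials (Fin 2) ℂ).constr_basis ℂ
    (fun d => (∏ i, ((d i).factorial : ℂ)) * coeff d u) d
  rw [coe_basisMonomials] at h
  rw [← mul_one (coeff d p), ← smul_eq_mul (coeff d p), ← smul_monomial, map_smul]
  rw [smul_eq_mul, mul_one]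
  refine Eq.trans ?_ (congrArg (coeff d p • ·) h).symm
  simp only [smul_eq_mul]
  ring

theorem pairing_add (p q u : Poly) : pairing (p + q) u = pairing p u + pairing q u := by
  simp only [pairing_eq, map_add]

theorem pairing_sum {ι : Type*} (s : Finset ι) (p : ι → Poly) (u : Poly) :
    pairing (∑ i ∈ s, p i) u = ∑ i ∈ s, pairing (p i) u := by
  simp only [pairing_eq, map_sum]

theorem pairing_C_mul (a : ℂ) (p u : Poly) : pairing (C a * p) u = a * pairing p u := by
  simp only [pairing_eq, ← smul_eq_C_mul, map_smul, smul_eq_mul]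

theorem pairing_dividedMonomial (a b : ℕ) (u : Poly) :
    pairing (dividedMonomial a b) u = coeff (expo a b) u := by
  have h := (basisMonomials (Fin 2) ℂ).constr_basis ℂ
    (fun d => (∏ i, ((d i).factorial : ℂ)) * coeff d u) (expo a b)
  rw [coe_basisMonomials, Fin.prod_univ_two, expo_zero, expo_one] at h
  rw [dividedMonomial, pairing_C_mul, pairing_eq, ← mono, mono_eq_monomial]
  refine (congrArg (_ * ·) h).trans ?_
  have ha : (a.factorial : ℂ) ≠ 0 := Nat.cast_ne_zero.2 a.factorial_ne_zero
  have hb : (b.factorial : ℂ) ≠ 0 := Nat.cast_ne_zero.2 b.factorial_ne_zero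
  field_simp

theorem dividedMonomial_isHomogeneous {a b N : ℕ} (h : a + b = N) :
    (dividedMonomial a b).IsHomogeneous N := by
  subst h
  exact (mono_isHomogeneous a b).C_mul _

/-- The polynomial `p_{2n,c}`. -/
def charPoly (m : ℕ) (c : ℂ) (n q : ℕ) : Poly :=
  dividedMonomial n n + ∑ k ∈ Finset.Icc 1 q,
    C ((-1 : ℂ) ^ (m * k) * pochRatio c k) * symMonomial (n - m * k) (n + m * k)

theorem charPoly_isHomogeneous {m n q : ℕ} (c : ℂ) (hq : m * q ≤ n) :
    (charPoly m c n q).IsHomogeneous (2 * n) := by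
  refine (dividedMonomial_isHomogeneous (by omega)).add (IsHomogeneous.sum _ _ _ fun k hk => ?_)
  have hk : m * k ≤ n := (Nat.mul_le_mul_left m (Finset.mem_Icc.1 hk).2).trans hq
  exact ((dividedMonomial_isHomogeneous (by omega)).add
    (dividedMonomial_isHomogeneous (by omega))).C_mul _

theorem moment_two_mul {m : ℕ} (hm : m ≠ 0) (c : ℂ) (k : ℕ) :
    moment m c (2 * ((m * k : ℕ) : ℤ)) = (-1 : ℂ) ^ (m * k) * pochRatio c k := by
  rw [show (2 * ((m * k : ℕ) : ℤ)) = 2 * m * (k : ℤ) by push_cast; ring, moment_mul hm,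
    zpow_natCast, ← pow_mul, Int.natAbs_natCast]

/-- Divided monomials are dual to monomials, so the pairing reads off the coefficients of `u`
weighted by moments. The bounds on `q` say that `1, …, q` account for all positive multiples of `m`
up to `n`. -/
theorem pairing_charPoly {m n q : ℕ} (hm : m ≠ 0) (c : ℂ) (hq : m * q ≤ n)
    (hq' : n < m * (q + 1)) {u : Poly} (hu : u.IsHomogeneous (2 * n)) :
    pairing (charPoly m c n q) u = phi m c u := by
  have hm' : 0 < m := Nat.pos_of_ne_zero hm
  simp only [charPoly, symMonomial, pairing_add, pairing_sum, pairing_C_mul,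
    pairing_dividedMonomial]
  have key := map_eq_of_isHomogeneous (k := 2 * n)
    (lcoeff ℂ (expo n n) + ∑ k ∈ Finset.Icc 1 q, ((-1 : ℂ) ^ (m * k) * pochRatio c k) •
      (lcoeff ℂ (expo (n - m * k) (n + m * k)) + lcoeff ℂ (expo (n + m * k) (n - m * k))))
    (phi m c) (fun a b hab => ?_) hu
  · rw [← key]
    simp only [LinearMap.add_apply, LinearMap.sum_apply, LinearMap.smul_apply, lcoeff_apply,
      smul_eq_mul]
  · have hco : ∀ x y, x + y = 2 * n → coeff (expo x y) (mono a b) = if a = x then 1 else 0 := by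
      intro x y hxy
      rw [mono_eq_monomial, coeff_monomial]
      refine if_congr ⟨fun h => (expo_injective h).1, ?_⟩ rfl rfl
      rintro rfl
      rw [show b = y by omega]
    simp only [LinearMap.add_apply, LinearMap.sum_apply, LinearMap.smul_apply, lcoeff_apply,
      smul_eq_mul]
    rw [phi_mono, hco n n (by omega)]
    have hle : ∀ k ∈ Finset.Icc 1 q, m * k ≤ n := fun k hk =>
      (Nat.mul_le_mul_left m (Finset.mem_Icc.1 hk).2).trans hq
    rw [Finset.sum_congr rfl fun k hk => by
      rw [hco _ _ (by have := hle k hk; omega), hco _ _ (by have := hle k hk; omega)]]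
    have hpos : ∀ k ∈ Finset.Icc 1 q, 0 < m * k := fun k hk =>
      Nat.mul_pos hm' (Finset.mem_Icc.1 hk).1
    obtain ⟨s, hs⟩ : ∃ s, a = n + s ∨ n = a + s := by
      rcases le_total n a with h | h
      · exact ⟨a - n, Or.inl (by omega)⟩
      · exact ⟨n - a, Or.inr (by omega)⟩
    have hsn : s ≤ n := by omega
    have hmom : moment m c ((a : ℤ) - b) = moment m c (2 * (s : ℤ)) := by
      rcases hs with h | h
      · congr 1; omega
      · rw [← moment_neg hm]; congr 1; omega
    rw [hmom]
    rcases Nat.eq_zero_or_pos s with rfl | hspos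
    · rw [if_pos (by omega), Finset.sum_eq_zero fun k hk => by
        have := hpos k hk
        have := hle k hk
        rw [if_neg (by omega), if_neg (by omega), add_zero, mul_zero]]
      simp [moment_zero hm]
    · rw [if_neg (by omega), zero_add]
      by_cases hd : m ∣ s
      · obtain ⟨k, rfl⟩ := hd
        have hk1 : 1 ≤ k := Nat.pos_of_mul_pos_left hspos
        have hkq : k ≤ q := Nat.le_of_lt_succ (Nat.lt_of_mul_lt_mul_left (hsn.trans_lt hq'))
        rw [Finset.sum_eq_single_of_mem k (Finset.mem_Icc.2 ⟨hk1, hkq⟩), moment_two_mul hm]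
        · have h1 : ((if a = n - m * k then (1 : ℂ) else 0) + if a = n + m * k then 1 else 0)
              = 1 := by
            rcases hs with h | h
            · rw [if_neg (by omega), if_pos h, zero_add]
            · rw [if_pos (by omega), if_neg (by omega), add_zero]
          rw [h1, mul_one]
        · intro j hj hjk
          have h1 : m * j ≠ m * k := fun h => hjk (Nat.eq_of_mul_eq_mul_left hm' h)
          have := hle j hj
          rw [if_neg (by omega), if_neg (by omega), add_zero, mul_zero]
      · rw [moment_of_not_dvd, Finset.sum_eq_zero]
        · intro j hj
          have h1 : m * j ≠ s := fun h => hd ⟨j, h.symm⟩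
          have := hle j hj
          rw [if_neg (by omega), if_neg (by omega), add_zero, mul_zero]
        · rw [mul_dvd_mul_iff_left two_ne_zero, Int.natCast_dvd_natCast]
          exact hd

theorem isCharacteristicPolynomial {m n q : ℕ} (hm : m ≠ 0) {c : ℂ} (hq : m * q ≤ n)
    (hq' : n < m * (q + 1)) (hc : ∀ k : ℕ, 1 ≤ k → m * k ≤ n → c ≠ k)
    (hF : IsStandardFrobenius (quotientComponent (quasiharmonicIdeal m c (n + 1))) (2 * n)) :
    IsCharacteristicPolynomial (quasiharmonicIdeal m c (n + 1)) (2 * n) (charPoly m c n q) := by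
  refine ⟨charPoly_isHomogeneous c hq, fun u hu => ?_⟩
  rw [pairing_charPoly hm c hq hq' hu]
  have hle := quasiharmonicIdeal_le_momentIdeal hm hc
    fun i hi => mul_ne_of_isStandardFrobenius hm hc hF hi
  refine ⟨fun h => (mem_momentIdeal_iff_phi hu).1 (hle h), fun h => ?_⟩
  obtain ⟨-, -, -, -, -, hN, -⟩ := hF
  set J := quasiharmonicIdeal m c (n + 1)
  have he := e2_pow_isHomogeneous n
  -- Since `φ` vanishes on `J` in degree `2n` but not on `e₂^n`, the class of `e₂^n` spans the
  -- one-dimensional top component. Writing `u` as `a e₂^n` modulo `J` and applying `φ` gives `a =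
  -- φ(u)`.
  have hne : (⟨_, mk_mem_quotientComponent (J := J) he⟩ : quotientComponent J (2 * n)) ≠ 0 := by
    intro h0
    have h1 := hle (Ideal.Quotient.eq_zero_iff_mem.1 (congrArg Subtype.val h0))
    rw [mem_momentIdeal_iff_phi he, phi_e2_pow hm] at h1
    exact one_ne_zero h1
  obtain ⟨a, ha⟩ := (finrank_eq_one_iff_of_nonzero' _ hne).1 hN
    ⟨_, mk_mem_quotientComponent (J := J) hu⟩
  have ha' : Ideal.Quotient.mkₐ ℂ J (a • (X 0 * X 1) ^ n) = Ideal.Quotient.mkₐ ℂ J u :=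
    (map_smul _ _ _).trans (congrArg Subtype.val ha)
  have hd : a • (X 0 * X 1) ^ n - u ∈ J := Ideal.Quotient.eq.1 ha'
  have ha0 : a = 0 := by
    have h1 := hle hd
    rw [mem_momentIdeal_iff_phi (Submodule.sub_mem _ (Submodule.smul_mem _ _ he) hu :
      (a • (X 0 * X 1) ^ n - u) ∈ homogeneousSubmodule (Fin 2) ℂ (2 * n)), map_sub, map_smul,
      phi_e2_pow hm, h, smul_eq_mul, mul_one, sub_zero] at h1
    exact h1
  rw [ha0, zero_smul, zero_sub] at hd
  exact (Ideal.neg_mem_iff _).1 hd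

end DihedralCherednik

end

theorem mainTheorem10 (m : ℕ) (hm : 3 ≤ m) (c : ℂ) (n q r : ℕ)
    (hn : n = m * q + r) (hr : r < m)
    (hc : ∀ k ∈ Finset.Icc 1 q, c ≠ (k : ℂ)) :
    (DihedralCherednik.IsRegular m c →
      DihedralCherednik.IsStandardFrobenius
        (DihedralCherednik.quotientComponent
          (DihedralCherednik.quasiharmonicIdeal m c (n + 1))) (2 * n)) ∧
    (DihedralCherednik.IsStandardFrobenius
        (DihedralCherednik.quotientComponent
          (DihedralCherednik.quasiharmonicIdeal m c (n + 1))) (2 * n) →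
      DihedralCherednik.IsCharacteristicPolynomial
        (DihedralCherednik.quasiharmonicIdeal m c (n + 1)) (2 * n)
        (DihedralCherednik.dividedMonomial n n +
          ∑ k ∈ Finset.Icc 1 q,
            MvPolynomial.C ((-1 : ℂ) ^ (m * k) *
              ((∏ i ∈ Finset.Icc 1 k, (c + (i : ℂ) - 1)) /
                (∏ i ∈ Finset.Icc 1 k, ((i : ℂ) - c)))) *
            DihedralCherednik.symMonomial (n - m * k) (n + m * k))) := by
  have hm0 : m ≠ 0 := by omega
  have hq : m * q ≤ n := by omega
  have hq' : n < m * (q + 1) := by rw [mul_add, mul_one]; omega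
  have hc' : ∀ k : ℕ, 1 ≤ k → m * k ≤ n → c ≠ k := fun k hk hkn =>
    hc k (Finset.mem_Icc.2 ⟨hk, Nat.le_of_lt_succ (Nat.lt_of_mul_lt_mul_left (hkn.trans_lt hq'))⟩)
  exact ⟨fun hreg => DihedralCherednik.isStandardFrobenius hm0 hc' hreg,
    fun hF => DihedralCherednik.isCharacteristicPolynomial hm0 hq hq' hc' hF⟩
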